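/- Let $n\ge 1$, $0<\lambda_{min}\le\lambda_{max}$ and $d>0$. There exist constants $C>0$ and $\gamma\in(0,1)$, depending only on $n,\lambda_{min},\lambda_{max}$ and $d$, such that the following holds. Let $Q_1=\{x\in\mathbb R^n: |x_i|<1/2,\ i=1,\dots,n\}$ and let $D\subset Q_1$ be a set with $\overline D\subset Q_1$ and $dist(\overline D,\partial Q_1)\ge d$ (no condition if $D=\emptyset$). Let $A=(a^{ij})$ be a continuous field of symmetric $n\times n$ matrices on $\mathbb R^n$ with $A(x)\ne 0$ for every $x$ and $$\tilde\lambda_{min}(x)\, I\le A(x)\le\tilde\lambda_{max}(x)\, I\qquad\text{for all }x\in\mathbb R^n,$$ where $\tilde\lambda_{min},\tilde\lambda_{max}:\mathbb R^n\to[0,\infty)$ are periodic of period $1$ in each coordinate and $$\lambda_{min}\le\tilde\lambda_{min}(x)\le\tilde\lambda_{max}(x)\le\lambda_{max}\qquad\text{for }x\in Q_1\setminus D.$$ Let $\varepsilon>0$ and let $u$ be a continuous function in the unit ball $B_1$ with $|u|\le 1$ that solves $$L_\varepsilon u(x)=\sum_{i,j}a^{ij}\!\left(\frac x\varepsilon\right)u_{ij}(x)=0\qquad\text{in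 }B_1$$ in the viscosity sense: whenever a function $\varphi$ of class $C^2$ near $x_0\in B_1$ touches $u$ at $x_0$ from below (respectively from above) in a neighbourhood of $x_0$, then $L_\varepsilon\varphi(x_0)\le 0$ (respectively $L_\varepsilon\varphi(x_0)\ge0$). Then $$|u(x)-u(y)|\le C|x-y|^\gamma\qquad\text{for all }x,y\in B_{1/2}\text{ with }|x-y|\ge\varepsilon.$$ -/

import Mathlib

open Set Filter Topology

noncomputable section

/-- The second partial derivative `φ_{ij}(x)` of a function on `ℝⁿ`. -/
def secondPartial {n : ℕ} (φ : EuclideanSpace ℝ (Fin n) → ℝ) (x : EuclideanSpace ℝ (Fin n))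
    (i j : Fin n) : ℝ :=
  fderiv ℝ (fderiv ℝ φ) x (EuclideanSpace.single i 1) (EuclideanSpace.single j 1)

/-- The operator in nondivergence form `∑ᵢⱼ aⁱʲ(x) φ_{ij}(x)` with coefficient matrix field `a`,
acting on a function that is twice differentiable at `x`. -/
def nondivOp {n : ℕ} (a : EuclideanSpace ℝ (Fin n) → Matrix (Fin n) (Fin n) ℝ)
    (φ : EuclideanSpace ℝ (Fin n) → ℝ) (x : EuclideanSpace ℝ (Fin n)) : ℝ :=
  ∑ i, ∑ j, a x i j * secondPartial φ x i j

/-- `u` is a (continuous) viscosity solution of `aⁱʲ(x) u_{ij} = 0` in the open set `Ω`: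
a function `φ`, of class `C²` near a point `x₀ ∈ Ω`, that touches `u` at `x₀` from below
(resp. above) in a neighbourhood of `x₀` satisfies `aⁱʲ(x₀) φ_{ij}(x₀) ≤ 0` (resp. `≥ 0`). -/
structure IsViscositySolution {n : ℕ} (a : EuclideanSpace ℝ (Fin n) → Matrix (Fin n) (Fin n) ℝ)
    (Ω : Set (EuclideanSpace ℝ (Fin n))) (u : EuclideanSpace ℝ (Fin n) → ℝ) : Prop where
  continuousOn : ContinuousOn u Ω
  supersolution : ∀ x₀ ∈ Ω, ∀ φ : EuclideanSpace ℝ (Fin n) → ℝ, ContDiffAt ℝ 2 φ x₀ →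
    φ x₀ = u x₀ → (∀ᶠ x in 𝓝 x₀, φ x ≤ u x) → nondivOp a φ x₀ ≤ 0
  subsolution : ∀ x₀ ∈ Ω, ∀ φ : EuclideanSpace ℝ (Fin n) → ℝ, ContDiffAt ℝ 2 φ x₀ →
    φ x₀ = u x₀ → (∀ᶠ x in 𝓝 x₀, u x ≤ φ x) → 0 ≤ nondivOp a φ x₀

/-- The open unit cube `Q₁ = {x : |xᵢ| < 1/2 for all i}`. -/
def unitCube (n : ℕ) : Set (EuclideanSpace ℝ (Fin n)) :=
  {x | ∀ i, |x i| < 1 / 2}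

/-- A function on `ℝⁿ` that is periodic of period `1` in every coordinate direction. -/
def IsUnitPeriodic {n : ℕ} (f : EuclideanSpace ℝ (Fin n) → ℝ) : Prop :=
  ∀ x, ∀ i, f (x + EuclideanSpace.single i 1) = f x

end

/-! ### Sliding paraboloids corrected by a bounded function -/

section Sliding

variable {V : Type*} [NormedAddCommGroup V] [InnerProductSpace ℝ V]

/-! After scaling by `ε⁻¹` the coefficients vary at unit scale and the claim becomes a Hölder bound
at distances at least 1. Ellipticity is uniform only near the faces of the lattice cubes; elsewhere
the matrix may degenerate, but its trace stays positive, so a strictly convex quadratic polynomial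
never touches the solution from below.

The degenerate region is handled by a corrector `ω`: bounded, semiconvex, and uniformly convex away
from the faces (`exists_isCorrector`). Slide paraboloids corrected by a multiple of `ω` under the
solution. Where `ω` is convex the corrected test function is convex, so contact is impossible there;
and since `0 ≤ ω ≤ m`, the correction is negligible at scales well above `√m`. At those scales
`SlideSetup.norm_vertex_sub_le`, a barrier argument, bounds the displacement of the vertex by that
of the contact point. This replaces the Jacobian estimate of the contact map in Savin's method, and
Vitali coverings turn it into growth of the neighbourhood of the touching points, until it fills
more than half of a ball (`exists_measure_diff_touchNhd_lt`).

Suppose a solution with values in `[0, 1]` comes very close to both 0 and 1 in a large ball. Then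
`u` and `1 - u` are both touched there by wide paraboloids, and by the half-measure bound some
touching points of the two lie at bounded distance (`exists_touchSet_close`). They are moved into
the elliptic frame and along segments in it to one common small ball. In that ball `ω = 0` is
admissible, so the same meeting lemma holds at every scale and gives arbitrarily close points with
`u ≤ 1/4` and `1 - u ≤ 1/4`, against uniform continuity. Thus the oscillation decays at large scales
(`exists_osc_decay`), and iteration over radii `R / 100 ^ i` gives the Hölder bound. In dimension
one the frame is disconnected, but there the equation divided by its trace is elliptic everywhere.
-/

/-- The points of `K` at which `u` is touched from below on all of `K` by a paraboloid with
quadratic part `-a ‖x‖²`. -/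
def touchSet (u : V → ℝ) (K : Set V) (a : ℝ) : Set V :=
  {x ∈ K | ∃ p : V, ∀ x' ∈ K, u x + inner ℝ p (x' - x) - a * ‖x' - x‖ ^ 2 ≤ u x'}

/-- A test function `α ⟨e, x⟩² - β ‖x‖² + β ω(x)` (up to affine terms) that touches `u` from below
at a point of `Ω` satisfies `α ≤ L β`. -/
def TiltedTest (u ω : V → ℝ) (Ω : Set V) (L : ℝ) : Prop :=
  ∀ x₀ ∈ Ω, ∀ p e : V, ‖e‖ = 1 → ∀ α β : ℝ, 0 ≤ α → 0 < β →
    (∀ᶠ x in 𝓝 x₀, u x₀ + inner ℝ p (x - x₀) + α * inner ℝ e (x - x₀) ^ 2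
      - β * ‖x - x₀‖ ^ 2 + β * (ω x - ω x₀) ≤ u x) → α ≤ L * β

/-- The standing assumptions for sliding paraboloids, corrected by multiples of `ω`, under `u`. -/
structure SlideSetup (u ω : V → ℝ) (Ω K : Set V) (L κ m : ℝ) : Prop where
  isCompact : IsCompact K
  continuousOn : ContinuousOn u K
  subset : Ω ⊆ K
  continuous : Continuous ω
  nonneg : ∀ x, 0 ≤ ω x
  le_bound : ∀ x, ω x ≤ m
  one_le : 1 ≤ L
  kappa_nonneg : 0 ≤ κ
  semiconvex : ∀ x, ∃ p : V, ∀ x', ω x + inner ℝ p (x' - x) - κ * ‖x' - x‖ ^ 2 ≤ ω x'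
  test : TiltedTest u ω Ω L

/-- The difference of `u` and the corrected paraboloid with vertex `y`, built on the paraboloid with
slope `p` at `z`. -/
def slideGap (u ω : V → ℝ) (a : ℝ) (z p y x : V) : ℝ :=
  u x - u z - inner ℝ p (x - z) + a * ‖x - z‖ ^ 2 + a * ‖x - y‖ ^ 2 - 2 * a * ω x

theorem touchSet_mono {u : V → ℝ} {K : Set V} {a b : ℝ} (hab : a ≤ b) :
    touchSet u K a ⊆ touchSet u K b := by
  rintro x ⟨hx, p, hp⟩
  refine ⟨hx, p, fun x' hx' => ?_⟩
  have := hp x' hx'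
  have : a * ‖x' - x‖ ^ 2 ≤ b * ‖x' - x‖ ^ 2 := by gcongr
  linarith

theorem norm_sub_sq_expand (x b c : V) :
    ‖x - c‖ ^ 2 = ‖x - b‖ ^ 2 + 2 * inner ℝ (b - c) (x - b) + ‖b - c‖ ^ 2 := by
  have : x - c = (x - b) + (b - c) := by abel
  rw [this, norm_add_sq_real, real_inner_comm]

variable {u ω : V → ℝ} {Ω K : Set V} {L κ m : ℝ}

/-- A minimum of the gap is a point where `u` is touched by a paraboloid of larger opening. -/
theorem SlideSetup.mem_touchSet (h : SlideSetup u ω Ω K L κ m) {a : ℝ} (ha : 0 < a)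
    {z p y x : V} (hx : x ∈ K)
    (hmin : ∀ x' ∈ K, slideGap u ω a z p y x ≤ slideGap u ω a z p y x') :
    x ∈ touchSet u K (2 * (1 + κ) * a) := by
  -- The opening `2(1 + κ)a` comes from two paraboloids of opening `a` and the semiconvexity `κ` of
  -- `ω`, taken `2a` times.
  obtain ⟨q, hq⟩ := h.semiconvex x
  refine ⟨hx, p + (-2 * a) • (x - z) + (-2 * a) • (x - y) + (2 * a) • q, fun x' hx' => ?_⟩
  have h1 := hmin x' hx'
  have h2 := mul_le_mul_of_nonneg_left (hq x') (by positivity : 0 ≤ 2 * a)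
  unfold slideGap at h1
  rw [norm_sub_sq_expand x' x z, norm_sub_sq_expand x' x y] at h1
  have e1 : x' - z = (x' - x) + (x - z) := by abel
  rw [e1] at h1
  simp only [inner_add_left, inner_add_right, real_inner_smul_left] at h1 ⊢
  linarith

/-- Comparing the minimum of the gap with its value at `z`, the touching paraboloid at `z` absorbs
the terms in `u`, and `0 ≤ ω ≤ m` leaves only the error `2m`. -/
theorem SlideSetup.exists_contact (h : SlideSetup u ω Ω K L κ m) {a : ℝ} (ha : 0 < a)
    {z p : V} (hz : z ∈ K)
    (hp : ∀ x' ∈ K, u z + inner ℝ p (x' - z) - a * ‖x' - z‖ ^ 2 ≤ u x') (y : V) :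
    ∃ x ∈ K, (∀ x' ∈ K, slideGap u ω a z p y x ≤ slideGap u ω a z p y x') ∧
      ‖x - y‖ ^ 2 ≤ ‖z - y‖ ^ 2 + 2 * m := by
  have hc : ContinuousOn (slideGap u ω a z p y) K := by
    have h1 := h.continuousOn
    have h2 := h.continuous
    unfold slideGap
    fun_prop
  obtain ⟨x, hx, hmin⟩ := h.isCompact.exists_isMinOn ⟨z, hz⟩ hc
  refine ⟨x, hx, fun x' hx' => hmin hx', ?_⟩
  have h1 : slideGap u ω a z p y x ≤ slideGap u ω a z p y z := hmin hz
  have h2 := hp x hx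
  simp only [slideGap, sub_self, inner_zero_right, norm_zero] at h1
  have h3 := h.le_bound x
  have h4 := h.nonneg z
  have h5 : a * ‖x - y‖ ^ 2 ≤ a * (‖z - y‖ ^ 2 + 2 * m) := by
    nlinarith
  exact le_of_mul_le_mul_left h5 ha

/-- The vertex depends on the contact point in a Lipschitz way, at scales above `√m`. -/
theorem SlideSetup.norm_vertex_sub_le [FiniteDimensional ℝ V] (h : SlideSetup u ω Ω K L κ m)
    {a : ℝ} (ha : 0 < a)
    {z p x y x' y' : V} {t : ℝ} (ht : 0 < t) (hm : m ≤ t ^ 2) (hxx : ‖x' - x‖ ≤ t)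
    (hball : Metric.closedBall x (6 * L * t) ⊆ Ω) (hx'K : x' ∈ K)
    (hmin : ∀ w ∈ K, slideGap u ω a z p y x ≤ slideGap u ω a z p y w)
    (hmin' : ∀ w ∈ K, slideGap u ω a z p y' x' ≤ slideGap u ω a z p y' w) :
    ‖y' - y‖ ≤ 32 * L * t := by
  rcases eq_or_ne y' y with rfl | hne
  · have := h.one_le
    simp only [sub_self, norm_zero]; positivity
  have hL := h.one_le
  have hd : 0 < ‖y' - y‖ := norm_pos_iff.2 (sub_ne_zero.2 hne)
  set e : V := (‖y' - y‖)⁻¹ • (y' - y) with he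
  have hen : ‖e‖ = 1 := by
    rw [he, norm_smul, norm_inv, norm_norm, inv_mul_cancel₀ hd.ne']
  have hye : y' - y = ‖y' - y‖ • e := by
    rw [he, smul_smul, mul_inv_cancel₀ hd.ne', one_smul]
  -- `A` makes `A (4t)²` equal to the lower bound `2a‖y' - y‖t` for `W` on the face `⟨e, w - x⟩ =
  -- 2t`; `B` makes the barrier nonpositive on the sphere of radius `6Lt`.
  obtain ⟨A, hA⟩ : ∃ A : ℝ, A = 2 * a * ‖y' - y‖ / (16 * t) := ⟨_, rfl⟩
  have hApos : 0 < A := by rw [hA]; positivity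
  have hAt : 16 * t * A = 2 * a * ‖y' - y‖ := by rw [hA]; field_simp
  obtain ⟨B, hB⟩ : ∃ B : ℝ, B = 4 * A / (9 * L ^ 2) := ⟨_, rfl⟩
  have hBpos : 0 < B := by rw [hB]; positivity
  have hBL : B * (9 * L ^ 2) = 4 * A := by rw [hB]; field_simp
  -- The barrier `φ` exceeds `W` at `x` and lies below it on the boundary of the slab piece `G`, so
  -- `W - φ` has an interior minimum, at which the equation bounds `A`.
  let φ : V → ℝ := fun w =>
    A * (inner ℝ e (w - x) + 2 * t) ^ 2 - B * ‖w - x‖ ^ 2 + B * (ω w - m)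
  let W : V → ℝ := fun w => slideGap u ω a z p y w - slideGap u ω a z p y x
  let G : Set V := {w | w ∈ Metric.closedBall x (6 * L * t) ∧ |inner ℝ e (w - x)| ≤ 2 * t}
  have hGK : ∀ w ∈ G, w ∈ K := fun w hw => h.subset (hball hw.1)
  have hGc : IsCompact G := by
    refine (isCompact_closedBall x (6 * L * t)).inter_right ?_
    exact isClosed_le (f := fun w => |inner ℝ e (w - x)|) (by fun_prop) continuous_const
  have hxG : x ∈ G := by
    refine ⟨Metric.mem_closedBall_self (by positivity), ?_⟩
    simp only [sub_self, inner_zero_right, abs_zero]; positivity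
  have hφc : ContinuousOn φ G := by
    have := h.continuous
    fun_prop
  have hWc : ContinuousOn W G := by
    have h1 := h.continuousOn.mono hGK
    have h2 := h.continuous
    simp only [W, slideGap]
    fun_prop
  obtain ⟨w₀, hw₀, hw₀min⟩ := hGc.exists_isMinOn ⟨x, hxG⟩ (hWc.sub hφc)
  have hW0 : ∀ w ∈ G, 0 ≤ W w := fun w hw => sub_nonneg.2 (hmin w (hGK w hw))
  have hxe : inner ℝ e (x' - x) ≤ t := by
    calc inner ℝ e (x' - x) ≤ ‖e‖ * ‖x' - x‖ := real_inner_le_norm _ _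
      _ ≤ t := by rw [hen, one_mul]; exact hxx
  -- The gaps for `y` and `y'` differ by an affine function of slope parallel to `y' - y`;
  -- minimality at `x'` and at `x` then forces `W` to grow in the direction `e`.
  have hWlin : ∀ w ∈ G, 2 * a * ‖y' - y‖ * (inner ℝ e (w - x) - t) ≤ W w := by
    intro w hw
    have h1 := hmin' w (hGK w hw)
    have h2 := hmin x' hx'K
    have h3 : inner ℝ (y' - y) (w - x') = ‖y' - y‖ * (inner ℝ e (w - x) - inner ℝ e (x' - x)) := by
      conv_lhs => rw [hye]
      rw [real_inner_smul_left, ← inner_sub_right]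
      congr 2; abel
    have h4 : ‖x' - y'‖ ^ 2 - ‖x' - y‖ ^ 2 - ‖w - y'‖ ^ 2 + ‖w - y‖ ^ 2
        = 2 * inner ℝ (y' - y) (w - x') := by
      rw [norm_sub_sq_expand w x' y', norm_sub_sq_expand w x' y]
      simp only [inner_sub_left]; ring
    have h5 : 0 ≤ 2 * a * ‖y' - y‖ * (t - inner ℝ e (x' - x)) :=
      mul_nonneg (by positivity) (by linarith)
    simp only [W]
    simp only [slideGap] at h1 h2 ⊢
    rw [h3] at h4
    have h6 : a * (‖x' - y'‖ ^ 2 - ‖x' - y‖ ^ 2 - ‖w - y'‖ ^ 2 + ‖w - y‖ ^ 2) =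
      a * (2 * (‖y' - y‖ * (inner ℝ e (w - x) - inner ℝ e (x' - x)))) := by rw [h4]
    nlinarith
  have hneg : W w₀ - φ w₀ < 0 := by
    have h1 : W w₀ - φ w₀ ≤ W x - φ x := hw₀min hxG
    have h2 : W x = 0 := by simp [W]
    have h3 : φ x = A * (2 * t) ^ 2 + B * (ω x - m) := by simp [φ]
    have h4 := h.nonneg x
    have h5 : B * m ≤ B * t ^ 2 := by gcongr
    have h6 : B ≤ A := by
      have : B * (9 * 1 ^ 2) ≤ B * (9 * L ^ 2) := by gcongr
      linarith
    have h7 : B * t ^ 2 ≤ A * t ^ 2 := by gcongr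
    have h8 : 0 < A * t ^ 2 := by positivity
    nlinarith [mul_nonneg hBpos.le h4]
  have hωm : ∀ w, B * (ω w - m) ≤ 0 := fun w =>
    mul_nonpos_of_nonneg_of_nonpos hBpos.le (by linarith [h.le_bound w])
  have hint1 : ‖w₀ - x‖ < 6 * L * t := by
    by_contra hcon
    push Not at hcon
    have h1 := hW0 w₀ hw₀
    have h2 : φ w₀ ≤ 0 := by
      have h3 : (6 * L * t) ^ 2 ≤ ‖w₀ - x‖ ^ 2 := by gcongr
      have h4 : (inner ℝ e (w₀ - x) + 2 * t) ^ 2 ≤ (4 * t) ^ 2 := by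
        obtain ⟨h5, h6⟩ := abs_le.1 hw₀.2
        apply pow_le_pow_left₀ <;> linarith
      have h5 : A * (inner ℝ e (w₀ - x) + 2 * t) ^ 2 ≤ A * (4 * t) ^ 2 := by gcongr
      have h6 : B * (6 * L * t) ^ 2 ≤ B * ‖w₀ - x‖ ^ 2 := by gcongr
      have h7 := hωm w₀
      simp only [φ]
      nlinarith
    linarith
  have hint2 : |inner ℝ e (w₀ - x)| < 2 * t := by
    by_contra hcon
    push Not at hcon
    have h0 := le_antisymm hw₀.2 hcon
    have hN : 0 ≤ B * ‖w₀ - x‖ ^ 2 := by positivity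
    have h7 := hωm w₀
    rcases (abs_eq (by positivity)).1 h0 with h1 | h1
    · have h2 := hWlin w₀ hw₀
      simp only [φ] at hneg
      rw [h1] at h2 hneg
      rw [← hAt] at h2
      nlinarith
    · have h2 := hW0 w₀ hw₀
      simp only [φ] at hneg
      rw [h1] at hneg
      nlinarith
  have hnhds : ∀ᶠ w in 𝓝 w₀, w ∈ G := by
    have h1 : ∀ᶠ w in 𝓝 w₀, ‖w - x‖ < 6 * L * t :=
      
      ContinuousAt.eventually_lt (by fun_prop) continuousAt_const hint1
    have h2 : ∀ᶠ w in 𝓝 w₀, |inner ℝ e (w - x)| < 2 * t :=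
      
      ContinuousAt.eventually_lt (by fun_prop) continuousAt_const hint2
    filter_upwards [h1, h2] with w hw1 hw2
    exact ⟨by rw [mem_closedBall_iff_norm]; exact hw1.le, hw2.le⟩
  -- The multiples `2a` from the gap and `B` from the barrier add up to the coefficient of `ω` that
  -- matches the opening `B + 2a` in `TiltedTest`.
  have hkey : A ≤ L * (B + 2 * a) := by
    refine h.test w₀ (hball hw₀.1)
      (p + (2 * A * (inner ℝ e (w₀ - x) + 2 * t)) • e + (-2 * B) • (w₀ - x)
        + (-2 * a) • (w₀ - z) + (-2 * a) • (w₀ - y)) e hen A (B + 2 * a) hApos.le (by positivity) ?_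
    filter_upwards [hnhds] with w hw
    have h1 : W w₀ - φ w₀ ≤ W w - φ w := hw₀min hw
    simp only [W, φ, slideGap] at h1
    rw [norm_sub_sq_expand w w₀ x, norm_sub_sq_expand w w₀ y, norm_sub_sq_expand w w₀ z] at h1
    have e1 : w - z = (w - w₀) + (w₀ - z) := by abel
    have e2 : w - x = (w - w₀) + (w₀ - x) := by abel
    rw [e1, e2] at h1
    simp only [inner_add_left, inner_add_right, real_inner_smul_left] at h1 ⊢
    linarith
  have h8 : L * B ≤ A * (4 / 9) := by
    have : L * B * (9 * L) = 4 * A := by rw [← hBL]; ring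
    have h9 : 0 < L * B := by positivity
    nlinarith
  have h9 : A ≤ 4 * (L * a) := by
    have : L * (B + 2 * a) = L * B + 2 * (L * a) := by ring
    have h0 : 0 < L * a := by positivity
    linarith
  have h10 : a * ‖y' - y‖ ≤ a * (32 * L * t) := by
    have := mul_le_mul_of_nonneg_left h9 (by positivity : 0 ≤ 16 * t)
    linarith
  exact le_of_mul_le_mul_left h10 ha

/-- Points where `u` is touched spread: one finds some that are closer to a given center. -/
theorem SlideSetup.exists_closer [FiniteDimensional ℝ V] (h : SlideSetup u ω Ω K L κ m)
    {a : ℝ} (ha : 0 < a) {z x₀ : V} {r : ℝ} (hr : 0 < r) (hz : z ∈ touchSet u K a)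
    (hzr : ‖z - x₀‖ ≤ r) (hm : 2 * m ≤ (1 / (2048 * L)) ^ 2 * r ^ 2)
    (hball : Metric.closedBall x₀ (3 * r) ⊆ Ω) :
    ∃ x ∈ touchSet u K (2 * (1 + κ) * a), ‖x - x₀‖ ≤ (1 - (1 / (2048 * L)) ^ 2) * r := by
  have hL := h.one_le
  obtain ⟨s, hs⟩ : ∃ s, s = 1 / (2048 * L) := ⟨_, rfl⟩
  rw [← hs] at hm ⊢
  have hs0 : 0 < s := by rw [hs]; positivity
  have hsL : s * (2048 * L) = 1 := by rw [hs]; field_simp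
  have hs1 : s ≤ 1 / 2048 := by nlinarith
  by_cases hcase : ‖z - x₀‖ ≤ (1 - s ^ 2) * r
  · refine ⟨z, touchSet_mono ?_ hz, hcase⟩
    have := h.kappa_nonneg
    nlinarith
  push Not at hcase
  by_contra hcon
  push Not at hcon
  obtain ⟨hzK, p, hp⟩ := hz
  -- If no touching point is closer to `x₀`, then pulling the vertex from `z` towards `x₀` hardly
  -- moves the contact point. Two values of `τ` then give vertices about `r/4` apart with contacts
  -- within `4sr`, too close for `norm_vertex_sub_le`.
  have key : ∀ τ : ℝ, 0 < τ → τ ≤ 1 / 2 → ∃ x ∈ K,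
      (∀ x' ∈ K, slideGap u ω a z p (z - τ • (z - x₀)) x ≤
        slideGap u ω a z p (z - τ • (z - x₀)) x') ∧ ‖x - z‖ ≤ 2 * s * r := by
    intro τ hτ hτ2
    obtain ⟨x, hx, hmin, hloc⟩ := h.exists_contact ha hzK hp (z - τ • (z - x₀))
    refine ⟨x, hx, hmin, ?_⟩
    have h1 := hcon x (h.mem_touchSet ha hx hmin)
    have h2 : x - (z - τ • (z - x₀)) = (x - z) + τ • (z - x₀) := by abel
    have h3 : z - (z - τ • (z - x₀)) = τ • (z - x₀) := by abel
    rw [h2, h3, norm_add_sq_real, real_inner_smul_right] at hloc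
    have h4 : x - x₀ = (x - z) + (z - x₀) := by abel
    have h5 : ((1 - s ^ 2) * r) ^ 2 ≤ ‖x - x₀‖ ^ 2 := by
      apply pow_le_pow_left₀ _ h1.le
      have : s ^ 2 ≤ 1 := by nlinarith
      exact mul_nonneg (by linarith) hr.le
    rw [h4, norm_add_sq_real] at h5
    have h6 : ‖z - x₀‖ ^ 2 ≤ r ^ 2 := by gcongr
    have h7 : ‖x - z‖ ^ 2 ≤ (2 * s * r) ^ 2 := by
      have h8 : -2 * s ^ 2 * r ^ 2 ≤ 2 * inner ℝ (x - z) (z - x₀) + ‖x - z‖ ^ 2 := by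
        nlinarith [sq_nonneg (s ^ 2 * r)]
      have h9 := mul_le_mul_of_nonneg_left h8 hτ.le
      have h10 : τ * ‖x - z‖ ^ 2 ≤ 1 / 2 * ‖x - z‖ ^ 2 := by gcongr
      have h11 : τ * (2 * s ^ 2 * r ^ 2) ≤ 1 / 2 * (2 * s ^ 2 * r ^ 2) := by gcongr
      nlinarith
    exact le_of_sq_le_sq h7 (by positivity)
  obtain ⟨x₁, hx₁, hmin₁, hd₁⟩ := key (1 / 2) (by norm_num) le_rfl
  obtain ⟨x₂, hx₂, hmin₂, hd₂⟩ := key (1 / 4) (by norm_num) (by norm_num)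
  have hd : ‖x₂ - x₁‖ ≤ 4 * s * r := by
    have : x₂ - x₁ = (x₂ - z) - (x₁ - z) := by abel
    rw [this]
    linarith [norm_sub_le (x₂ - z) (x₁ - z)]
  have hb : Metric.closedBall x₁ (6 * L * (4 * s * r)) ⊆ Ω := by
    refine subset_trans (Metric.closedBall_subset_closedBall' ?_) hball
    have h1 : dist x₁ x₀ ≤ 2 * s * r + r := by
      rw [dist_eq_norm]
      have : x₁ - x₀ = (x₁ - z) + (z - x₀) := by abel
      rw [this]
      linarith [norm_add_le (x₁ - z) (z - x₀)]
    nlinarith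
  have hm' : m ≤ (4 * s * r) ^ 2 := by nlinarith [mul_pos hs0 hr]
  have h1 := h.norm_vertex_sub_le ha (by positivity) hm' hd hb hx₂ hmin₁ hmin₂
  have h2 : z - (1 / 4 : ℝ) • (z - x₀) - (z - (1 / 2 : ℝ) • (z - x₀)) =
      (1 / 4 : ℝ) • (z - x₀) := by
    module
  rw [h2, norm_smul] at h1
  norm_num at h1
  have h3 : 32 * L * (4 * s * r) = r / 16 := by
    linear_combination (r / 16) * hsL
  rw [h3] at h1
  have : s ^ 2 ≤ 1 / 4 := by nlinarith
  nlinarith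

/-- The smallness of `m` is required at the last, smallest radius, so it holds at every earlier step
of the iteration. -/
theorem SlideSetup.exists_close_iterate [FiniteDimensional ℝ V] (h : SlideSetup u ω Ω K L κ m)
    {x₀ : V} {r : ℝ} (hr : 0 < r) (N : ℕ)
    (hm : 2 * m ≤ (1 / (2048 * L)) ^ 2 * ((1 - (1 / (2048 * L)) ^ 2) ^ N * r) ^ 2)
    (hball : Metric.closedBall x₀ (3 * r) ⊆ Ω) {a : ℝ} (ha : 0 < a) {z : V}
    (hz : z ∈ touchSet u K a) (hzr : ‖z - x₀‖ ≤ r) :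
    ∃ x ∈ touchSet u K ((2 * (1 + κ)) ^ N * a),
      ‖x - x₀‖ ≤ (1 - (1 / (2048 * L)) ^ 2) ^ N * r := by
  have hL := h.one_le
  have hκ := h.kappa_nonneg
  obtain ⟨c, hc⟩ : ∃ c, c = (1 / (2048 * L)) ^ 2 := ⟨_, rfl⟩
  have hc0 : 0 < c := by rw [hc]; positivity
  have hc1 : c ≤ 1 / 2 := by
    have : 1 / (2048 * L) ≤ 1 / 2048 := by
      apply one_div_le_one_div_of_le <;> linarith
    have h0 : 0 ≤ 1 / (2048 * L) := by positivity
    rw [hc]; nlinarith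
  rw [← hc] at hm ⊢
  induction N with
  | zero => exact ⟨z, by simpa using hz, by simpa using hzr⟩
  | succ N ih =>
    have hle : (1 - c) ^ (N + 1) * r ≤ (1 - c) ^ N * r := by
      have : (1 - c) ^ (N + 1) ≤ (1 - c) ^ N := by
        apply pow_le_pow_of_le_one <;> linarith
      gcongr
    have hpos : 0 < (1 - c) ^ (N + 1) * r := by
      have : 0 < 1 - c := by linarith
      positivity
    have hpos' : 0 < (1 - c) ^ N * r := by linarith
    have hmN : 2 * m ≤ c * ((1 - c) ^ N * r) ^ 2 := by
      refine hm.trans ?_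
      gcongr
    obtain ⟨x, hx, hxr⟩ := ih hmN
    have hb : Metric.closedBall x₀ (3 * ((1 - c) ^ N * r)) ⊆ Ω := by
      refine subset_trans (Metric.closedBall_subset_closedBall ?_) hball
      have : (1 - c) ^ N ≤ 1 := pow_le_one₀ (by linarith) (by linarith)
      nlinarith
    obtain ⟨x', hx', hxr'⟩ := h.exists_closer (by positivity) hpos' hx hxr (by rw [← hc]; exact hmN) hb
    refine ⟨x', ?_, ?_⟩
    · convert hx' using 2; ring
    · rw [← hc] at hxr'
      calc _ ≤ _ := hxr'
        _ = _ := by ring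

end Sliding

/-! ### Covering arguments and local growth of the touching set -/

section Growth

open MeasureTheory

section Nhd

variable {V : Type*} [NormedAddCommGroup V] [InnerProductSpace ℝ V]

/-- The `δ`-neighbourhood of the touching points in the ball `B(x₀, ϱ)`. -/
def touchNhd (u : V → ℝ) (K : Set V) (x₀ : V) (ϱ δ a : ℝ) : Set V :=
  Metric.thickening δ (touchSet u K a ∩ Metric.ball x₀ ϱ)

theorem touchNhd_mono {u : V → ℝ} {K : Set V} {x₀ : V} {ϱ δ a b : ℝ} (hab : a ≤ b) :
    touchNhd u K x₀ ϱ δ a ⊆ touchNhd u K x₀ ϱ δ b :=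
  Metric.thickening_subset_of_subset _ (inter_subset_inter_left _ (touchSet_mono hab))

end Nhd

variable {V : Type*} [NormedAddCommGroup V] [InnerProductSpace ℝ V] [FiniteDimensional ℝ V]
  [MeasurableSpace V] [BorelSpace V] (μ : Measure V)

/-- If nearby values of `f` come from nearby points of `Y`, at scale `δ`, then `Y` is not much
larger than the `δ`-neighbourhood of its image. -/
theorem measure_le_measure_thickening_image [μ.IsAddHaarMeasure] {Y : Set V} {f : V → V} {δ M : ℝ} (hδ : 0 < δ)
    (hM : 0 ≤ M)
    (hf : ∀ y ∈ Y, ∀ y' ∈ Y, ‖f y' - f y‖ ≤ 5 * (δ / 2) → ‖y' - y‖ ≤ M * δ) :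
    μ Y ≤ ENNReal.ofReal ((2 * M) ^ Module.finrank ℝ V) * μ (Metric.thickening δ (f '' Y)) := by
  -- The selected balls are disjoint around image points, while the balls counted on the other side
  -- are centred at the corresponding vertices; both kinds are indexed by `I`.
  obtain ⟨I, hIY, hdisj, hcov⟩ := Vitali.exists_disjoint_subfamily_covering_enlargement_closedBall
    Y f (fun _ => δ / 2) (δ / 2) (fun _ _ => le_rfl) 5 (by norm_num)
  have hcount : I.Countable := by
    refine hdisj.countable_of_nonempty_interior fun i _ => ⟨f i, ?_⟩
    exact Metric.ball_subset_interior_closedBall (Metric.mem_ball_self (by positivity))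
  have h1 : Y ⊆ ⋃ b ∈ I, Metric.closedBall b (M * δ) := by
    intro y hy
    obtain ⟨b, hb, hyb⟩ := hcov y hy
    refine mem_iUnion₂.2 ⟨b, hb, ?_⟩
    have := hyb (Metric.mem_closedBall_self (by positivity))
    rw [mem_closedBall_iff_norm] at this ⊢
    exact hf b (hIY hb) y hy this
  have h2 : (⋃ b ∈ I, Metric.closedBall (f b) (δ / 2)) ⊆ Metric.thickening δ (f '' Y) := by
    refine iUnion₂_subset fun b hb w hw => ?_
    refine Metric.mem_thickening_iff.2 ⟨f b, mem_image_of_mem f (hIY hb), ?_⟩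
    rw [Metric.mem_closedBall] at hw
    linarith
  have h3 : ∀ b : V, μ (Metric.closedBall b (M * δ)) =
      ENNReal.ofReal ((2 * M) ^ Module.finrank ℝ V) * μ (Metric.closedBall (f b) (δ / 2)) := by
    intro b
    rw [Measure.addHaar_closedBall μ _ (by positivity), Measure.addHaar_closedBall μ _ (by positivity),
      ← mul_assoc, ← ENNReal.ofReal_mul (by positivity), ← mul_pow]
    congr 3; ring
  calc μ Y ≤ μ (⋃ b ∈ I, Metric.closedBall b (M * δ)) := measure_mono h1
    _ ≤ ∑' b : I, μ (Metric.closedBall (b : V) (M * δ)) := measure_biUnion_le μ hcount _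
    _ = ENNReal.ofReal ((2 * M) ^ Module.finrank ℝ V) *
        ∑' b : I, μ (Metric.closedBall (f b) (δ / 2)) := by
          rw [← ENNReal.tsum_mul_left]; exact tsum_congr fun b => h3 b
    _ = ENNReal.ofReal ((2 * M) ^ Module.finrank ℝ V) *
        μ (⋃ b ∈ I, Metric.closedBall (f b) (δ / 2)) := by
          rw [measure_biUnion hcount hdisj fun b _ => measurableSet_closedBall]
    _ ≤ _ := by gcongr

variable {u ω : V → ℝ} {Ω K : Set V} {L κ m : ℝ}

/-- One touching point near the center of a ball produces many of them. -/
theorem SlideSetup.measure_ball_le [μ.IsAddHaarMeasure] (h : SlideSetup u ω Ω K L κ m) {a : ℝ} (ha : 0 < a)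
    {z x₁ : V} {s δ : ℝ} (hδ : 0 < δ) (hδs : 30 * L * δ ≤ s) (hm : m ≤ δ ^ 2)
    (hz : z ∈ touchSet u K a) (hzs : ‖z - x₁‖ ≤ s / 8) (hball : Metric.closedBall x₁ (2 * s) ⊆ Ω) :
    μ (Metric.ball x₁ (s / 8)) ≤ ENNReal.ofReal ((160 * L) ^ Module.finrank ℝ V) *
      μ (Metric.thickening δ (touchSet u K (2 * (1 + κ) * a) ∩ Metric.closedBall x₁ (s / 2))) := by
  have hL := h.one_le
  have hs : 30 * δ ≤ s := by nlinarith
  obtain ⟨hzK, p, hp⟩ := hz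
  -- One contact point for each vertex `y`: `f` inverts the vertex map and need not be measurable.
  choose f hfK hfmin hfloc using fun y => h.exists_contact ha hzK hp y
  have hfs : ∀ y ∈ Metric.ball x₁ (s / 8), ‖f y - x₁‖ ≤ s / 2 := by
    intro y hy
    rw [mem_ball_iff_norm] at hy
    have h1 := hfloc y
    have h2 : ‖z - y‖ ≤ s / 4 := by
      have : z - y = (z - x₁) - (y - x₁) := by abel
      rw [this]
      linarith [norm_sub_le (z - x₁) (y - x₁)]
    have h3 : ‖z - y‖ ^ 2 ≤ (s / 4) ^ 2 := by gcongr
    have h4 : ‖f y - y‖ ≤ 3 * s / 8 := by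
      apply le_of_sq_le_sq _ (by linarith)
      nlinarith
    have : f y - x₁ = (f y - y) + (y - x₁) := by abel
    rw [this]
    linarith [norm_add_le (f y - y) (y - x₁)]
  have key := measure_le_measure_thickening_image μ (Y := Metric.ball x₁ (s / 8)) (f := f)
    (δ := δ) (M := 80 * L) hδ (by positivity) (by
      intro y hy y' _ hyy
      have hb : Metric.closedBall (f y) (6 * L * (5 * (δ / 2))) ⊆ Ω := by
        refine subset_trans (Metric.closedBall_subset_closedBall' ?_) hball
        rw [dist_eq_norm]
        nlinarith [hfs y hy]
      have := h.norm_vertex_sub_le ha (by positivity) (by nlinarith) hyy hb (hfK y') (hfmin y)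
        (hfmin y')
      linarith)
  have h2 : (2 * (80 * L)) = 160 * L := by ring
  rw [h2] at key
  refine key.trans ?_
  gcongr
  refine Metric.thickening_subset_of_subset _ ?_
  rintro _ ⟨y, hy, rfl⟩
  exact ⟨h.mem_touchSet ha (hfK y) (hfmin y), by rw [mem_closedBall_iff_norm]; exact hfs y hy⟩

/-- A covering argument: a uniform local gain of `F'` over `F` near the points that `F'` misses
gives a global gain. -/
theorem measure_diff_le_of_local_gain {B F F' : Set V} {R : ℝ} {Q : ENNReal}
    (hlocal : ∀ x ∈ B \ F', ∃ (x₁ : V) (s : ℝ), 0 < s ∧ s ≤ R ∧ x ∈ Metric.closedBall x₁ s ∧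
      Metric.ball x₁ s ⊆ B \ F ∧ μ (Metric.closedBall x₁ (5 * s)) ≤ Q * μ (F' ∩ Metric.ball x₁ s)) :
    μ (B \ F') ≤ Q * μ ((B ∩ F') \ F) := by
  choose! c s hs hsR hxs hsub hgain using hlocal
  obtain ⟨I, hI, hdisj, hcov⟩ := Vitali.exists_disjoint_subfamily_covering_enlargement_closedBall
    (B \ F') c s R hsR 5 (by norm_num)
  have hcount : I.Countable := by
    refine hdisj.countable_of_nonempty_interior fun i hi => ⟨c i, ?_⟩
    exact Metric.ball_subset_interior_closedBall (Metric.mem_ball_self (hs i (hI hi)))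
  have hdisj' : I.PairwiseDisjoint fun i => Metric.ball (c i) (s i) := fun i hi j hj hij =>
    (hdisj hi hj hij).mono Metric.ball_subset_closedBall Metric.ball_subset_closedBall
  have h1 : B \ F' ⊆ ⋃ b ∈ I, Metric.closedBall (c b) (5 * s b) := by
    intro x hx
    obtain ⟨b, hb, hxb⟩ := hcov x hx
    exact mem_iUnion₂.2 ⟨b, hb, hxb (hxs x hx)⟩
  -- Restricting `μ` to `F'` gives additivity over the balls without measurability of `F'`.
  have hsum : ∑' b : I, μ (F' ∩ Metric.ball (c b) (s b)) =
      μ (F' ∩ ⋃ b ∈ I, Metric.ball (c b) (s b)) := by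
    have e1 := measure_biUnion (μ := μ.restrict F') hcount hdisj' fun b _ => measurableSet_ball
    have hmeas : MeasurableSet (⋃ b ∈ I, Metric.ball (c b) (s b)) :=
      MeasurableSet.biUnion hcount fun b _ => measurableSet_ball
    rw [Measure.restrict_apply hmeas] at e1
    rw [inter_comm, e1]
    refine tsum_congr fun b => ?_
    rw [Measure.restrict_apply measurableSet_ball, inter_comm]
  calc μ (B \ F') ≤ μ (⋃ b ∈ I, Metric.closedBall (c b) (5 * s b)) := measure_mono h1
    _ ≤ ∑' b : I, μ (Metric.closedBall (c b) (5 * s b)) := measure_biUnion_le μ hcount _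
    _ ≤ ∑' b : I, Q * μ (F' ∩ Metric.ball (c b) (s b)) :=
        ENNReal.tsum_le_tsum fun b => hgain b (hI b.2)
    _ = Q * μ (F' ∩ ⋃ b ∈ I, Metric.ball (c b) (s b)) := by rw [ENNReal.tsum_mul_left, hsum]
    _ ≤ Q * μ ((B ∩ F') \ F) := by
        gcongr
        rintro x ⟨hxF, hx⟩
        obtain ⟨b, hb, hxb⟩ := mem_iUnion₂.1 hx
        have := hsub b (hI hb) hxb
        exact ⟨⟨this.1, hxF⟩, this.2⟩

end Growth

/-! ### Filling more than half of a ball, and meeting of two touching sets -/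

section Meeting

open MeasureTheory

variable {V : Type*} [NormedAddCommGroup V] [InnerProductSpace ℝ V] [FiniteDimensional ℝ V]
  [MeasurableSpace V] [BorelSpace V] (μ : Measure V) [μ.IsAddHaarMeasure]
  {u ω : V → ℝ} {Ω K : Set V} {L κ m : ℝ}

/-- Let `x` be missed by the new neighbourhood, at distance `r` from the old touching points. A ball
of radius `r/8` next to `x` avoids the old neighbourhood; wider paraboloids touch near its centre,
and `measure_ball_le` makes the new neighbourhood fill a fixed fraction of it. Here `6400 = 40 ·
160`, from comparing balls of radii `5s` and `s/8`. -/
theorem SlideSetup.measure_diff_touchNhd_le (h : SlideSetup u ω Ω K L κ m) {N : ℕ}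
    (hN : (1 - (1 / (2048 * L)) ^ 2) ^ N ≤ 1 / 80) {a ϱ δ : ℝ} (ha : 0 < a) {x₀ : V}
    (hδ : 0 < δ) (hϱ : 0 < ϱ)
    (hm : 2 * m ≤ (1 / (2048 * L)) ^ 2 * ((1 - (1 / (2048 * L)) ^ 2) ^ N * δ) ^ 2)
    (hm' : m ≤ (δ / (60 * L)) ^ 2) (hball : Metric.closedBall x₀ (10 * ϱ) ⊆ Ω)
    (hne : (touchSet u K a ∩ Metric.ball x₀ ϱ).Nonempty) :
    μ (Metric.ball x₀ ϱ \ touchNhd u K x₀ ϱ δ ((2 * (1 + κ)) ^ (N + 1) * a)) ≤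
      ENNReal.ofReal ((6400 * L) ^ Module.finrank ℝ V) *
      μ ((Metric.ball x₀ ϱ ∩ touchNhd u K x₀ ϱ δ ((2 * (1 + κ)) ^ (N + 1) * a)) \
        touchNhd u K x₀ ϱ δ a) := by
  have hL := h.one_le
  have hκ := h.kappa_nonneg
  have h2κ : 1 ≤ 2 * (1 + κ) := by linarith
  have hc1 : 0 < 1 - (1 / (2048 * L)) ^ 2 := by
    have h1 : 1 / (2048 * L) ≤ 1 / 2048 := by
      apply one_div_le_one_div_of_le <;> linarith
    have h0 : 0 ≤ 1 / (2048 * L) := by positivity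
    nlinarith
  refine measure_diff_le_of_local_gain μ (R := ϱ) ?_
  rintro x ⟨hxB, hxF⟩
  have hxF0 : x ∉ touchNhd u K x₀ ϱ δ a := fun hx => hxF (touchNhd_mono (by
    have := one_le_pow₀ h2κ (n := N + 1)
    nlinarith) hx)
  obtain ⟨r, hr⟩ : ∃ r, r = Metric.infDist x (touchSet u K a ∩ Metric.ball x₀ ϱ) := ⟨_, rfl⟩
  have hδr : δ ≤ r := by
    rw [touchNhd, Metric.mem_thickening_iff_infDist_lt hne, not_lt] at hxF0
    rw [hr]; exact hxF0
  rw [Metric.mem_ball] at hxB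
  have hr2 : r ≤ 2 * ϱ := by
    obtain ⟨z, hz⟩ := hne
    have h1 := Metric.infDist_le_dist_of_mem (x := x) hz
    have h2 := Metric.mem_ball.1 hz.2
    rw [dist_comm] at h2
    linarith [dist_triangle x x₀ z]
  obtain ⟨s, hs⟩ : ∃ s, s = r / 8 := ⟨_, rfl⟩
  have hs0 : 0 < s := by linarith
  obtain ⟨z, hz, hxz⟩ : ∃ z ∈ touchSet u K a ∩ Metric.ball x₀ ϱ, dist x z < 9 * s := by
    apply (Metric.infDist_lt_iff hne).1; linarith
  -- The centre is shifted by at most `s` towards `x₀`, to keep the ball of radius `s` inside the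
  -- large one.
  obtain ⟨x₁, hx₁, hsub⟩ : ∃ x₁, dist x₁ x ≤ s ∧ Metric.ball x₁ s ⊆ Metric.ball x₀ ϱ := by
    refine ⟨x + (s / ϱ) • (x₀ - x), ?_, Metric.ball_subset_ball' ?_⟩
    · rw [dist_eq_norm, add_sub_cancel_left, norm_smul, Real.norm_of_nonneg (by positivity),
        ← dist_eq_norm, dist_comm]
      calc s / ϱ * dist x x₀ ≤ s / ϱ * ϱ := by gcongr
        _ = s := by field_simp
    · have e1 : x + (s / ϱ) • (x₀ - x) - x₀ = (1 - s / ϱ) • (x - x₀) := by module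
      have h1 : s / ϱ ≤ 1 := by rw [div_le_one hϱ]; linarith
      rw [dist_eq_norm, e1, norm_smul, Real.norm_of_nonneg (by linarith), ← dist_eq_norm]
      calc s + (1 - s / ϱ) * dist x x₀ ≤ s + (1 - s / ϱ) * ϱ := by
            have : 0 ≤ 1 - s / ϱ := by linarith
            gcongr
        _ = ϱ := by field_simp; ring
  have hx₁₀ : dist x₁ x₀ ≤ s + ϱ := by linarith [dist_triangle x₁ x x₀]
  have hz₁ : ‖z - x₁‖ ≤ 10 * s := by
    rw [← dist_eq_norm, dist_comm]
    linarith [dist_triangle x₁ x z]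
  obtain ⟨x', hx', hx'r⟩ := h.exists_close_iterate (r := 10 * s) (by positivity) N
    (hm.trans (by gcongr; linarith))
    (subset_trans (Metric.closedBall_subset_closedBall' (by linarith)) hball) ha hz.1 hz₁
  have hx's : ‖x' - x₁‖ ≤ s / 8 := by
    refine hx'r.trans ?_
    calc _ ≤ 1 / 80 * (10 * s) := by gcongr
      _ = s / 8 := by ring
  have hxx₁ : dist x x₁ ≤ s := by rw [dist_comm]; exact hx₁
  -- Otherwise `x'` is within `δ` of `x`, and `x` would lie in the new neighbourhood.
  have hr4 : 4 * δ < r := by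
    by_contra hcon
    push Not at hcon
    refine hxF (Metric.mem_thickening_iff.2 ⟨x', ⟨touchSet_mono ?_ hx', hsub ?_⟩, ?_⟩)
    · rw [pow_succ]
      have : 0 ≤ (2 * (1 + κ)) ^ N * a := by positivity
      nlinarith
    · rw [mem_ball_iff_norm]; linarith
    · rw [← dist_eq_norm, dist_comm] at hx's
      linarith [dist_triangle x x₁ x']
  have hδL : 30 * L * (δ / (60 * L)) = δ / 2 := by field_simp; norm_num
  have hδs : δ / (60 * L) ≤ s / 2 := by
    have : δ / (60 * L) ≤ δ / 60 := by
      apply div_le_div_of_nonneg_left <;> linarith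
    linarith
  have hδδ : δ / (60 * L) ≤ δ := by
    apply div_le_self hδ.le; linarith
  refine ⟨x₁, s, hs0, by linarith, hxx₁, fun w hw => ⟨hsub hw, fun hwF => ?_⟩, ?_⟩
  · obtain ⟨z', hz', hd⟩ := Metric.mem_thickening_iff.1 hwF
    have h1 := Metric.infDist_le_dist_of_mem (x := x) hz'
    rw [Metric.mem_ball, dist_comm] at hw
    linarith [dist_triangle x x₁ z', dist_triangle x₁ w z']
  have hmain := h.measure_ball_le μ (a := (2 * (1 + κ)) ^ N * a) (by positivity)
    (δ := δ / (60 * L)) (s := s) (by positivity) (by linarith) hm' hx' hx's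
    (subset_trans (Metric.closedBall_subset_closedBall' (by linarith)) hball)
  have e2 : 2 * (1 + κ) * ((2 * (1 + κ)) ^ N * a) = (2 * (1 + κ)) ^ (N + 1) * a := by ring
  rw [e2] at hmain
  have hsub2 : Metric.thickening (δ / (60 * L)) (touchSet u K ((2 * (1 + κ)) ^ (N + 1) * a) ∩
      Metric.closedBall x₁ (s / 2)) ⊆
      touchNhd u K x₀ ϱ δ ((2 * (1 + κ)) ^ (N + 1) * a) ∩ Metric.ball x₁ s := by
    intro w hw
    obtain ⟨q, ⟨hq1, hq2⟩, hd⟩ := Metric.mem_thickening_iff.1 hw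
    rw [Metric.mem_closedBall] at hq2
    refine ⟨Metric.mem_thickening_iff.2 ⟨q, ⟨hq1, hsub ?_⟩, by linarith⟩, ?_⟩
    · rw [Metric.mem_ball]; linarith
    · rw [Metric.mem_ball]; linarith [dist_triangle w q x₁]
  calc μ (Metric.closedBall x₁ (5 * s))
      = ENNReal.ofReal (40 ^ Module.finrank ℝ V) * μ (Metric.ball x₁ (s / 8)) := by
        rw [Measure.addHaar_closedBall μ _ (by positivity),
          Measure.addHaar_ball_of_pos μ x₁ (by positivity), ← mul_assoc,
          ← ENNReal.ofReal_mul (by positivity), ← mul_pow]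
        congr 3; ring
    _ ≤ ENNReal.ofReal (40 ^ Module.finrank ℝ V) *
        (ENNReal.ofReal ((160 * L) ^ Module.finrank ℝ V) *
        μ (touchNhd u K x₀ ϱ δ ((2 * (1 + κ)) ^ (N + 1) * a) ∩ Metric.ball x₁ s)) := by
        gcongr
        refine hmain.trans ?_
        gcongr
    _ = _ := by
        rw [← mul_assoc, ← ENNReal.ofReal_mul (by positivity), ← mul_pow]
        congr 3; ring

theorem exists_pow_contraction_le {L : ℝ} (hL : 1 ≤ L) {ε : ℝ} (hε : 0 < ε) :
    ∃ N : ℕ, (1 - (1 / (2048 * L)) ^ 2) ^ N ≤ ε := by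
  have h0 : 0 < 1 / (2048 * L) := by positivity
  have h1 : 1 / (2048 * L) ≤ 1 / 2048 := by
    apply one_div_le_one_div_of_le <;> linarith
  obtain ⟨N, hN⟩ := exists_pow_lt_of_lt_one hε
    (show 1 - (1 / (2048 * L)) ^ 2 < 1 by nlinarith)
  exact ⟨N, hN.le⟩

/-- After enlarging the opening by a fixed factor, the neighbourhood of the touching points fills
more than half of the ball. -/
theorem exists_measure_diff_touchNhd_lt (hL : 1 ≤ L) (hκ : 0 ≤ κ) :
    ∃ C c : ℝ, 1 ≤ C ∧ 0 < c ∧ ∀ (u ω : V → ℝ) (Ω K : Set V) (m a ϱ δ : ℝ) (x₀ : V),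
      SlideSetup u ω Ω K L κ m → 0 < a → 0 < ϱ → 0 < δ → m ≤ c * δ ^ 2 →
      Metric.closedBall x₀ (10 * ϱ) ⊆ Ω → (touchSet u K a ∩ Metric.ball x₀ ϱ).Nonempty →
      2 * μ (Metric.ball x₀ ϱ \ touchNhd u K x₀ ϱ δ (C * a)) < μ (Metric.ball x₀ ϱ) := by
  obtain ⟨N, hN⟩ := exists_pow_contraction_le hL (ε := 1 / 80) (by norm_num)
  obtain ⟨Q, hQ⟩ : ∃ Q, Q = (6400 * L) ^ Module.finrank ℝ V := ⟨_, rfl⟩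
  have hQ0 : 0 < Q := by rw [hQ]; positivity
  obtain ⟨k, hk⟩ := exists_pow_lt_of_lt_one (show (0 : ℝ) < 1 / 2 by norm_num)
    (show Q / (Q + 1) < 1 by rw [div_lt_one] <;> linarith)
  have hc1 : 0 < 1 - (1 / (2048 * L)) ^ 2 := by
    have h1 : 1 / (2048 * L) ≤ 1 / 2048 := by
      apply one_div_le_one_div_of_le <;> linarith
    have h0 : 0 ≤ 1 / (2048 * L) := by positivity
    nlinarith
  have h2κ : 1 ≤ 2 * (1 + κ) := by linarith
  obtain ⟨D, hD⟩ : ∃ D, D = (2 * (1 + κ)) ^ (N + 1) := ⟨_, rfl⟩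
  have hD1 : 1 ≤ D := by rw [hD]; exact one_le_pow₀ h2κ
  obtain ⟨c₁, hc₁⟩ : ∃ c₁, c₁ = (1 / (2048 * L)) ^ 2 * ((1 - (1 / (2048 * L)) ^ 2) ^ N) ^ 2 / 2 :=
    ⟨_, rfl⟩
  refine ⟨D ^ k, min c₁ ((1 / (60 * L)) ^ 2), one_le_pow₀ hD1, ?_, ?_⟩
  · apply lt_min
    · rw [hc₁]; positivity
    · positivity
  intro u ω Ω K m a ϱ δ x₀ h ha hϱ hδ hm hball hne
  have hm1 : 2 * m ≤ (1 / (2048 * L)) ^ 2 * ((1 - (1 / (2048 * L)) ^ 2) ^ N * δ) ^ 2 := by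
    have : m ≤ c₁ * δ ^ 2 := hm.trans (by gcongr; exact min_le_left _ _)
    rw [hc₁] at this
    rw [mul_pow]; linarith
  have hm2 : m ≤ (δ / (60 * L)) ^ 2 := by
    have : m ≤ (1 / (60 * L)) ^ 2 * δ ^ 2 := hm.trans (by gcongr; exact min_le_right _ _)
    calc m ≤ _ := this
      _ = _ := by ring
  let f : ℕ → ℝ := fun j => μ.real (Metric.ball x₀ ϱ \ touchNhd u K x₀ ϱ δ (D ^ j * a))
  -- The covering estimate reads `f (j+1) ≤ Q (f j - f (j+1))`, so the missed measure contracts by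
  -- `Q/(Q+1)`.
  have hstep : ∀ j, (Q + 1) * f (j + 1) ≤ Q * f j := by
    intro j
    have ha' : 0 < D ^ j * a := by positivity
    have hle : a ≤ D ^ j * a := by
      have := one_le_pow₀ hD1 (n := j)
      nlinarith
    have hne' := hne.mono (inter_subset_inter_left (Metric.ball x₀ ϱ) (touchSet_mono hle))
    have h1 := h.measure_diff_touchNhd_le μ hN ha' hδ hϱ hm1 hm2 hball hne'
    rw [← hD, ← hQ] at h1
    have e1 : D * (D ^ j * a) = D ^ (j + 1) * a := by ring
    rw [e1] at h1
    have hfin : ∀ s ⊆ Metric.ball x₀ ϱ, μ s ≠ ⊤ := fun s hs =>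
      ((measure_mono hs).trans_lt measure_ball_lt_top).ne
    have hsub : touchNhd u K x₀ ϱ δ (D ^ j * a) ⊆ touchNhd u K x₀ ϱ δ (D ^ (j + 1) * a) :=
      touchNhd_mono (by rw [← e1]; nlinarith)
    have h2 := (ENNReal.toReal_le_toReal (hfin _ sdiff_subset)
      (ENNReal.mul_ne_top ENNReal.ofReal_ne_top (hfin _ (sdiff_subset.trans inter_subset_left)))).2 h1
    rw [ENNReal.toReal_mul, ENNReal.toReal_ofReal hQ0.le] at h2
    have hmeas : MeasurableSet (touchNhd u K x₀ ϱ δ (D ^ (j + 1) * a)) :=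
      Metric.isOpen_thickening.measurableSet
    have h3 := measureReal_sdiff_add_inter (μ := μ)
      (s := Metric.ball x₀ ϱ \ touchNhd u K x₀ ϱ δ (D ^ j * a)) hmeas (hfin _ sdiff_subset)
    have e2 : (Metric.ball x₀ ϱ \ touchNhd u K x₀ ϱ δ (D ^ j * a)) \
        touchNhd u K x₀ ϱ δ (D ^ (j + 1) * a) =
        Metric.ball x₀ ϱ \ touchNhd u K x₀ ϱ δ (D ^ (j + 1) * a) := by
      rw [sdiff_sdiff, union_eq_self_of_subset_left hsub]
    have e3 : (Metric.ball x₀ ϱ \ touchNhd u K x₀ ϱ δ (D ^ j * a)) ∩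
        touchNhd u K x₀ ϱ δ (D ^ (j + 1) * a) =
        (Metric.ball x₀ ϱ ∩ touchNhd u K x₀ ϱ δ (D ^ (j + 1) * a)) \
        touchNhd u K x₀ ϱ δ (D ^ j * a) := by
      ext w; simp only [mem_inter_iff, Set.mem_sdiff]; tauto
    rw [e2, e3] at h3
    have h4 : f (j + 1) ≤ Q * μ.real ((Metric.ball x₀ ϱ ∩
        touchNhd u K x₀ ϱ δ (D ^ (j + 1) * a)) \ touchNhd u K x₀ ϱ δ (D ^ j * a)) := h2
    have h5 : f j = f (j + 1) + μ.real ((Metric.ball x₀ ϱ ∩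
        touchNhd u K x₀ ϱ δ (D ^ (j + 1) * a)) \ touchNhd u K x₀ ϱ δ (D ^ j * a)) := h3.symm
    rw [h5]; linarith
  have hf : ∀ j, f j ≤ (Q / (Q + 1)) ^ j * μ.real (Metric.ball x₀ ϱ) := by
    intro j
    induction j with
    | zero =>
      simp only [f, pow_zero, one_mul]
      exact measureReal_mono sdiff_subset measure_ball_lt_top.ne
    | succ j ih =>
      have h1 : f (j + 1) ≤ Q / (Q + 1) * f j := by
        rw [div_mul_eq_mul_div, le_div_iff₀ (by positivity)]
        linarith [hstep j]
      calc f (j + 1) ≤ Q / (Q + 1) * f j := h1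
        _ ≤ Q / (Q + 1) * ((Q / (Q + 1)) ^ j * μ.real (Metric.ball x₀ ϱ)) := by gcongr
        _ = _ := by ring
  have hpos : 0 < μ.real (Metric.ball x₀ ϱ) :=
    ENNReal.toReal_pos (Metric.measure_ball_pos μ x₀ hϱ).ne' measure_ball_lt_top.ne
  have hfin : μ (Metric.ball x₀ ϱ \ touchNhd u K x₀ ϱ δ (D ^ k * a)) ≠ ⊤ :=
    ((measure_mono sdiff_subset).trans_lt measure_ball_lt_top).ne
  rw [← ENNReal.toReal_lt_toReal (ENNReal.mul_ne_top (by norm_num) hfin) measure_ball_lt_top.ne,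
    ENNReal.toReal_mul]
  have h6 := hf k
  simp only [f, Measure.real] at h6 hpos
  norm_num
  nlinarith

/-- For two functions that are both touched in a ball, touching points of either one, for larger
openings, come close to each other. -/
theorem exists_touchSet_close (hL : 1 ≤ L) (hκ : 0 ≤ κ) :
    ∃ C c : ℝ, 1 ≤ C ∧ 0 < c ∧ ∀ (u₁ u₂ ω : V → ℝ) (Ω K : Set V) (m a ϱ δ : ℝ) (x₀ : V),
      SlideSetup u₁ ω Ω K L κ m → SlideSetup u₂ ω Ω K L κ m →
      0 < a → 0 < ϱ → 0 < δ → m ≤ c * δ ^ 2 → Metric.closedBall x₀ (10 * ϱ) ⊆ Ω →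
      (touchSet u₁ K a ∩ Metric.ball x₀ ϱ).Nonempty →
      (touchSet u₂ K a ∩ Metric.ball x₀ ϱ).Nonempty →
      ∃ x ∈ Metric.ball x₀ ϱ, ∃ z₁ ∈ touchSet u₁ K (C * a) ∩ Metric.ball x₀ ϱ,
        ∃ z₂ ∈ touchSet u₂ K (C * a) ∩ Metric.ball x₀ ϱ, dist x z₁ < δ ∧ dist x z₂ < δ := by
  obtain ⟨C, c, hC, hc, H⟩ := exists_measure_diff_touchNhd_lt
    (MeasureTheory.Measure.addHaar : Measure V) hL hκ
  refine ⟨C, c, hC, hc, ?_⟩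
  intro u₁ u₂ ω Ω K m a ϱ δ x₀ h₁ h₂ ha hϱ hδ hm hball hne₁ hne₂
  have H₁ := H u₁ ω Ω K m a ϱ δ x₀ h₁ ha hϱ hδ hm hball hne₁
  have H₂ := H u₂ ω Ω K m a ϱ δ x₀ h₂ ha hϱ hδ hm hball hne₂
  obtain ⟨x, hx, hx₁, hx₂⟩ : ∃ x ∈ Metric.ball x₀ ϱ, x ∈ touchNhd u₁ K x₀ ϱ δ (C * a) ∧
      x ∈ touchNhd u₂ K x₀ ϱ δ (C * a) := by
    by_contra hcon
    push Not at hcon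
    have hcov : Metric.ball x₀ ϱ ⊆ (Metric.ball x₀ ϱ \ touchNhd u₁ K x₀ ϱ δ (C * a)) ∪
        (Metric.ball x₀ ϱ \ touchNhd u₂ K x₀ ϱ δ (C * a)) := by
      intro x hx
      by_cases hx1 : x ∈ touchNhd u₁ K x₀ ϱ δ (C * a)
      · exact Or.inr ⟨hx, hcon x hx hx1⟩
      · exact Or.inl ⟨hx, hx1⟩
    have h1 := (measure_mono (μ := (MeasureTheory.Measure.addHaar : Measure V)) hcov).trans
      (measure_union_le _ _)
    have h2 := ENNReal.add_lt_add H₁ H₂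
    rw [← mul_add, ← two_mul] at h2
    exact absurd (mul_le_mul_right h1 2) (not_le.2 h2)
  obtain ⟨z₁, hz₁, hd₁⟩ := Metric.mem_thickening_iff.1 hx₁
  obtain ⟨z₂, hz₂, hd₂⟩ := Metric.mem_thickening_iff.1 hx₂
  exact ⟨x, hx, z₁, hz₁, z₂, hz₂, hd₁, hd₂⟩

end Meeting

/-! ### Using the corrector, and propagation inside the elliptic region -/

section Oscillation

variable {V : Type*} [NormedAddCommGroup V] [InnerProductSpace ℝ V]

/-- Supersolutions in `Ω`, tested by quadratic polynomials, of an equation with ellipticity ratio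
`L` in `U`, that may be arbitrarily degenerate elsewhere. -/
structure SuperTest (u : V → ℝ) (U Ω : Set V) (L : ℝ) : Prop where
  degenerate : ∀ x₀ ∈ Ω, ∀ (p : V) (β : ℝ), 0 < β →
    ¬ ∀ᶠ x in 𝓝 x₀, u x₀ + inner ℝ p (x - x₀) + β * ‖x - x₀‖ ^ 2 ≤ u x
  elliptic : TiltedTest u 0 (Ω ∩ U) L

/-- A bounded function with Hessian bounded from below, that is uniformly convex off `S`. -/
structure IsCorrector (ω : V → ℝ) (S : Set V) (κ m : ℝ) : Prop where
  continuous : Continuous ω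
  nonneg : ∀ x, 0 ≤ ω x
  le_bound : ∀ x, ω x ≤ m
  kappa_nonneg : 0 ≤ κ
  semiconvex : ∀ x, ∃ p : V, ∀ x', ω x + inner ℝ p (x' - x) - κ * ‖x' - x‖ ^ 2 ≤ ω x'
  convex : ∀ x ∉ S, ∃ p : V, ∀ᶠ x' in 𝓝 x,
    ω x + inner ℝ p (x' - x) + 2 * ‖x' - x‖ ^ 2 ≤ ω x'

/-- Every point is near some `v` to which all points of `S` are joined by two segments that stay
well inside `U`. -/
def JoinedInside (U S : Set V) (σ M : ℝ) : Prop :=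
  ∀ x, ∃ v, ‖v - x‖ ≤ M ∧ Metric.closedBall v (20 * σ) ⊆ U ∧ ∀ x' ∈ S, ∃ p,
    ‖p - x'‖ ≤ ‖v - x'‖ ∧ ‖v - p‖ ≤ ‖v - x'‖ ∧
    (∀ t ∈ Icc (0 : ℝ) 1, Metric.closedBall (x' + t • (p - x')) (6 * σ) ⊆ U) ∧
    (∀ t ∈ Icc (0 : ℝ) 1, Metric.closedBall (p + t • (v - p)) (6 * σ) ⊆ U)

variable {u ω : V → ℝ} {U S Ω K : Set V} {L κ m : ℝ}

/-- On `S`, semiconvexity absorbs `βω` into the opening at the cost of a factor `1 + κ`. Off `S`,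
the convexity of `βω` outweighs `-β‖x‖²`, and a convex polynomial would touch `u`. -/
theorem SuperTest.tiltedTest (h : SuperTest u U Ω L) (hω : IsCorrector ω S κ m) (hSU : S ⊆ U) :
    TiltedTest u ω Ω (L * (1 + κ)) := by
  intro x₀ hx₀ p e he α β hα hβ htest
  by_cases hS : x₀ ∈ S
  · obtain ⟨q, hq⟩ := hω.semiconvex x₀
    have hκ := hω.kappa_nonneg
    have h1 : α ≤ L * (β + β * κ) := by
      refine h.elliptic x₀ ⟨hx₀, hSU hS⟩ (p + β • q) e he α (β + β * κ) hα (by positivity) ?_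
      filter_upwards [htest] with x hx
      have h2 := mul_le_mul_of_nonneg_left (hq x) hβ.le
      simp only [inner_add_left, real_inner_smul_left, Pi.zero_apply]
      linarith
    linarith
  · exfalso
    obtain ⟨q, hq⟩ := hω.convex x₀ hS
    refine h.degenerate x₀ hx₀ (p + β • q) β hβ ?_
    filter_upwards [htest, hq] with x hx hqx
    have h2 := mul_le_mul_of_nonneg_left hqx hβ.le
    have h3 : 0 ≤ α * inner ℝ e (x - x₀) ^ 2 := by positivity
    simp only [inner_add_left, real_inner_smul_left]
    linarith

theorem SuperTest.slideSetup (h : SuperTest u U Ω L) (hω : IsCorrector ω S κ m) (hSU : S ⊆ U)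
    (hL : 1 ≤ L) (hK : IsCompact K) (hu : ContinuousOn u K) (hΩ : Ω ⊆ K) :
    SlideSetup u ω Ω K (L * (1 + κ)) κ m where
  isCompact := hK
  continuousOn := hu
  subset := hΩ
  continuous := hω.continuous
  nonneg := hω.nonneg
  le_bound := hω.le_bound
  one_le := by nlinarith [hω.kappa_nonneg]
  kappa_nonneg := hω.kappa_nonneg
  semiconvex := hω.semiconvex
  test := h.tiltedTest hω hSU

/-- Inside `U` no corrector is needed. With `m = 0` the sliding estimates have no lower limit on the
scale. -/
theorem SuperTest.slideSetup_zero (h : SuperTest u U Ω L) (hL : 1 ≤ L) (hK : IsCompact K)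
    (hu : ContinuousOn u K) (hΩ : Ω ⊆ K) : SlideSetup u 0 (Ω ∩ U) K L 0 0 where
  isCompact := hK
  continuousOn := hu
  subset := inter_subset_left.trans hΩ
  continuous := continuous_zero
  nonneg _ := le_rfl
  le_bound _ := le_rfl
  one_le := hL
  kappa_nonneg := le_rfl
  semiconvex x := ⟨0, fun x' => by simp⟩
  test := h.elliptic

/-- Near any touching point there is one in the set `S` where the corrector is not convex. -/
theorem SuperTest.exists_touchSet_inter (h : SuperTest u U Ω L) (hω : IsCorrector ω S κ m)
    (hSU : S ⊆ U) (hL : 1 ≤ L) (hK : IsCompact K) (hu : ContinuousOn u K) (hΩ : Ω ⊆ K)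
    (hΩo : IsOpen Ω) {a : ℝ} (ha : 0 < a) {z : V} (hz : z ∈ touchSet u K a)
    (hball : Metric.closedBall z (m + 1) ⊆ Ω) :
    ∃ x ∈ touchSet u K (2 * (1 + κ) * a), x ∈ S ∧ ‖x - z‖ ≤ m + 1 := by
  have H := h.slideSetup hω hSU hL hK hu hΩ
  obtain ⟨hzK, p, hp⟩ := hz
  obtain ⟨x, hx, hmin, hloc⟩ := H.exists_contact ha hzK hp z
  have hm : 0 ≤ m := (hω.nonneg z).trans (hω.le_bound z)
  have hxz : ‖x - z‖ ≤ m + 1 := by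
    apply le_of_sq_le_sq _ (by linarith)
    simp only [sub_self, norm_zero] at hloc
    nlinarith
  refine ⟨x, H.mem_touchSet ha hx hmin, ?_, hxz⟩
  -- Off `S` the term `2aω` contributes convexity `4a` against the concavity `2a` of the two
  -- paraboloids.
  by_contra hxS
  have hxΩ : x ∈ Ω := hball (by rw [mem_closedBall_iff_norm]; exact hxz)
  obtain ⟨q, hq⟩ := hω.convex x hxS
  refine h.degenerate x hxΩ (p + (-4 * a) • (x - z) + (2 * a) • q) (2 * a) (by positivity) ?_
  filter_upwards [hΩo.mem_nhds hxΩ, hq] with w hw hqw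
  have h1 := hmin w (hΩ hw)
  have h2 := mul_le_mul_of_nonneg_left hqw (by positivity : 0 ≤ 2 * a)
  unfold slideGap at h1
  rw [norm_sub_sq_expand w x z] at h1
  have e1 : w - z = (w - x) + (x - z) := by abel
  rw [e1] at h1
  simp only [inner_add_left, inner_add_right, real_inner_smul_left] at h1 ⊢
  linarith

/-- Touching points propagate along segments. -/
theorem exists_touchSet_along_segment [FiniteDimensional ℝ V] (hL : 1 ≤ L) (N : ℕ) :
    ∃ C : ℝ, 1 ≤ C ∧ ∀ (u : V → ℝ) (Ω K : Set V) (σ a : ℝ) (p q : V),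
      SlideSetup u 0 Ω K L 0 0 → 0 < σ → 0 < a → ‖q - p‖ ≤ N * σ →
      (∀ t ∈ Icc (0 : ℝ) 1, Metric.closedBall (p + t • (q - p)) (6 * σ) ⊆ Ω) →
      (touchSet u K a ∩ Metric.closedBall p σ).Nonempty →
      (touchSet u K (C * a) ∩ Metric.closedBall q σ).Nonempty := by
  obtain ⟨k, hk⟩ := exists_pow_contraction_le hL (ε := 1 / 2) (by norm_num)
  obtain ⟨D, hD⟩ : ∃ D : ℝ, D = (2 * (1 + 0)) ^ k := ⟨_, rfl⟩
  have hD1 : 1 ≤ D := by rw [hD]; exact one_le_pow₀ (by norm_num)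
  refine ⟨D ^ N, one_le_pow₀ hD1, ?_⟩
  intro u Ω K σ a p q h hσ ha hpq hseg hne
  rcases Nat.eq_zero_or_pos N with rfl | hN
  · have : q = p := by
      rw [← sub_eq_zero, ← norm_le_zero_iff]; simpa using hpq
    simpa [this] using hne
  have hN' : (0 : ℝ) < N := by exact_mod_cast hN
  -- A point within `σ` of one node is within `2σ` of the next; `k` contractions bring the distance
  -- back to `σ`.
  have key : ∀ j : ℕ, j ≤ N → (touchSet u K (D ^ j * a) ∩
      Metric.closedBall (p + ((j : ℝ) / N) • (q - p)) σ).Nonempty := by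
    intro j
    induction j with
    | zero => intro _; simpa using hne
    | succ j ih =>
      intro hj
      obtain ⟨z, hz, hzb⟩ := ih (by omega)
      rw [mem_closedBall_iff_norm] at hzb
      have hj' : ((j + 1 : ℕ) : ℝ) ≤ N := by exact_mod_cast hj
      have hz2 : ‖z - (p + (((j + 1 : ℕ) : ℝ) / N) • (q - p))‖ ≤ 2 * σ := by
        have e1 : z - (p + (((j + 1 : ℕ) : ℝ) / N) • (q - p)) =
            (z - (p + ((j : ℝ) / N) • (q - p))) - (1 / (N : ℝ)) • (q - p) := by
          push_cast
          module
        rw [e1]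
        have e2 : ‖(1 / (N : ℝ)) • (q - p)‖ ≤ σ := by
          rw [norm_smul, Real.norm_of_nonneg (by positivity), one_div_mul_eq_div,
            div_le_iff₀ hN', mul_comm]
          exact hpq
        linarith [norm_sub_le (z - (p + ((j : ℝ) / N) • (q - p))) ((1 / (N : ℝ)) • (q - p))]
      obtain ⟨x, hx, hxb⟩ := h.exists_close_iterate (r := 2 * σ) (by positivity) k
        (by simp only [mul_zero]; positivity) (by
          have e3 : 3 * (2 * σ) = 6 * σ := by ring
          rw [e3]
          exact hseg _ ⟨by positivity, by rw [div_le_one hN']; exact hj'⟩)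
        (by positivity) hz hz2
      refine ⟨x, ?_, ?_⟩
      · rw [← hD] at hx
        convert hx using 2; ring
      · rw [mem_closedBall_iff_norm]
        calc _ ≤ _ := hxb
          _ ≤ 1 / 2 * (2 * σ) := by gcongr
          _ = σ := by ring
  have := key N le_rfl
  rwa [div_self hN'.ne', one_smul, add_sub_cancel] at this

/-- A function with values in `[0, 1]` is small where it is touched by wide paraboloids, if it is
small somewhere. -/
theorem le_of_mem_touchSet {x₀ x z : V} {R a θ : ℝ} (hR : 0 < R) (ha : 0 < a)
    (hθ : θ ≤ 1 / 100) (haR : a * R ^ 2 ≤ 1 / 10000)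
    (hu0 : ∀ w ∈ Metric.closedBall x₀ (100 * R), 0 ≤ u w)
    (hu1 : ∀ w ∈ Metric.closedBall x₀ (100 * R), u w ≤ 1)
    (hz : z ∈ Metric.closedBall x₀ R) (huz : u z ≤ θ) (hx : x ∈ Metric.ball x₀ (4 * R))
    (hxt : x ∈ touchSet u (Metric.closedBall x₀ (100 * R)) a) : u x ≤ 1 / 4 := by
  obtain ⟨hxK, p, hp⟩ := hxt
  rw [mem_ball_iff_norm] at hx
  rw [mem_closedBall_iff_norm] at hz
  have hux := hu0 x hxK
  -- Following the touching paraboloid a distance `90R` in the direction of `p`, the bound `u ≤ 1`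
  -- limits its slope.
  have hpn : ‖p‖ * (90 * R) ≤ 1 + a * (90 * R) ^ 2 := by
    rcases eq_or_ne p 0 with rfl | hp0
    · simp only [norm_zero, zero_mul]; positivity
    have hpp : 0 < ‖p‖ := norm_pos_iff.2 hp0
    have hn : ‖(90 * R / ‖p‖) • p‖ = 90 * R := by
      rw [norm_smul, Real.norm_of_nonneg (by positivity)]; field_simp
    have hw : x + (90 * R / ‖p‖) • p ∈ Metric.closedBall x₀ (100 * R) := by
      rw [mem_closedBall_iff_norm]
      have e1 : x + (90 * R / ‖p‖) • p - x₀ = (x - x₀) + (90 * R / ‖p‖) • p := by abel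
      rw [e1]
      linarith [norm_add_le (x - x₀) ((90 * R / ‖p‖) • p)]
    have h1 := hp _ hw
    have h2 := hu1 _ hw
    rw [add_sub_cancel_left, hn, real_inner_smul_right, real_inner_self_eq_norm_sq] at h1
    have e2 : 90 * R / ‖p‖ * ‖p‖ ^ 2 = ‖p‖ * (90 * R) := by field_simp
    rw [e2] at h1
    linarith
  have hzx : ‖z - x‖ ≤ 5 * R := by
    have e1 : z - x = (z - x₀) - (x - x₀) := by abel
    rw [e1]
    linarith [norm_sub_le (z - x₀) (x - x₀)]
  have h1 := hp z (by rw [mem_closedBall_iff_norm]; linarith)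
  have h2 : -(‖p‖ * (5 * R)) ≤ inner ℝ p (z - x) := by
    have := (abs_le.1 (abs_real_inner_le_norm p (z - x))).1
    have h3 : ‖p‖ * ‖z - x‖ ≤ ‖p‖ * (5 * R) := by gcongr
    linarith
  have h4 : a * ‖z - x‖ ^ 2 ≤ a * (5 * R) ^ 2 := by gcongr
  nlinarith

/-- Where `u` is small it is touched nearby by a wide paraboloid. -/
theorem exists_mem_touchSet_of_le {x₀ z : V} {R θ : ℝ} (hR : 0 < R) (hθ : 0 < θ)
    (hK : IsCompact (Metric.closedBall x₀ (100 * R)))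
    (hu : ContinuousOn u (Metric.closedBall x₀ (100 * R)))
    (hu0 : ∀ w ∈ Metric.closedBall x₀ (100 * R), 0 ≤ u w)
    (hz : z ∈ Metric.closedBall x₀ R) (huz : u z ≤ θ) :
    (touchSet u (Metric.closedBall x₀ (100 * R)) (θ / R ^ 2) ∩
      Metric.ball x₀ (3 * R)).Nonempty := by
  have hzK : z ∈ Metric.closedBall x₀ (100 * R) :=
    Metric.closedBall_subset_closedBall (by linarith) hz
  have ha : 0 < θ / R ^ 2 := by positivity
  obtain ⟨x, hx, hmin⟩ := hK.exists_isMinOn ⟨z, hzK⟩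
    (hu.add (f := u) (g := fun w => θ / R ^ 2 * ‖w - z‖ ^ 2) (by fun_prop))
  refine ⟨x, ⟨hx, (-2 * (θ / R ^ 2)) • (x - z), fun w hw => ?_⟩, ?_⟩
  · have h1 : u x + θ / R ^ 2 * ‖x - z‖ ^ 2 ≤ u w + θ / R ^ 2 * ‖w - z‖ ^ 2 := hmin hw
    rw [norm_sub_sq_expand w x z] at h1
    rw [real_inner_smul_left]
    linarith
  · have h1 : u x + θ / R ^ 2 * ‖x - z‖ ^ 2 ≤ u z + θ / R ^ 2 * ‖z - z‖ ^ 2 := hmin hzK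
    have h2 := hu0 x hx
    have h3 : θ / R ^ 2 * ‖x - z‖ ^ 2 ≤ θ / R ^ 2 * R ^ 2 := by
      have : θ / R ^ 2 * R ^ 2 = θ := by field_simp
      rw [this]
      simp only [sub_self, norm_zero] at h1
      linarith
    have h4 := le_of_sq_le_sq (le_of_mul_le_mul_left h3 ha) hR.le
    rw [mem_closedBall_iff_norm] at hz
    rw [mem_ball_iff_norm]
    have e1 : x - x₀ = (x - z) + (z - x₀) := by abel
    rw [e1]
    linarith [norm_add_le (x - z) (z - x₀)]

end Oscillation

/-! ### No solution comes close to both bounds at large scales -/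

section Decay

variable {V : Type*} [NormedAddCommGroup V] [InnerProductSpace ℝ V] [FiniteDimensional ℝ V]

/-- From a touching point, one reaches the center `v` of the ball joined to it. -/
theorem exists_touchSet_near_center {L κ m σ T : ℝ} (hL : 1 ≤ L) (hκ : 0 ≤ κ) (hσ : 0 < σ) :
    ∃ C : ℝ, 1 ≤ C ∧ ∀ (u ω : V → ℝ) (U S Ω K : Set V) (a : ℝ) (z v : V),
      SuperTest u U Ω L → IsCorrector ω S κ m → S ⊆ U → IsCompact K → ContinuousOn u K →
      Ω ⊆ K → IsOpen Ω → 0 < a → z ∈ touchSet u K a → ‖v - z‖ ≤ T →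
      Metric.closedBall v (3 * (T + m + 1) + 6 * σ) ⊆ Ω →
      (∀ x' ∈ S, ∃ p, ‖p - x'‖ ≤ ‖v - x'‖ ∧ ‖v - p‖ ≤ ‖v - x'‖ ∧
        (∀ t ∈ Icc (0 : ℝ) 1, Metric.closedBall (x' + t • (p - x')) (6 * σ) ⊆ U) ∧
        (∀ t ∈ Icc (0 : ℝ) 1, Metric.closedBall (p + t • (v - p)) (6 * σ) ⊆ U)) →
      (touchSet u K (C * a) ∩ Metric.closedBall v σ).Nonempty := by
  obtain ⟨N, hN⟩ := exists_nat_ge ((T + m + 1) / σ)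
  rw [div_le_iff₀ hσ] at hN
  obtain ⟨C, hC, HC⟩ := exists_touchSet_along_segment (V := V) hL N
  refine ⟨C * (C * (2 * (1 + κ))), ?_, ?_⟩
  · have : 1 ≤ C * (2 * (1 + κ)) := by nlinarith
    nlinarith
  intro u ω U S Ω K a z v h hω hSU hK hu hΩ hΩo ha hz hvz hball hjoin
  have hm : 0 ≤ m := (hω.nonneg z).trans (hω.le_bound z)
  have hT : 0 ≤ T := (norm_nonneg _).trans hvz
  obtain ⟨x, hx, hxS, hxz⟩ := h.exists_touchSet_inter hω hSU hL hK hu hΩ hΩo ha hz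
    (subset_trans (Metric.closedBall_subset_closedBall' (by
      rw [dist_eq_norm, norm_sub_rev]; linarith)) hball)
  obtain ⟨p, hp1, hp2, hs1, hs2⟩ := hjoin x hxS
  have hvx : ‖v - x‖ ≤ T + m + 1 := by
    have e1 : v - x = (v - z) - (x - z) := by abel
    rw [e1]
    linarith [norm_sub_le (v - z) (x - z)]
  have H := h.slideSetup_zero hL hK hu hΩ
  have hseg : ∀ q w : V, ‖w - v‖ ≤ 2 * (T + m + 1) → ‖q - w‖ ≤ T + m + 1 →
      ∀ t ∈ Icc (0 : ℝ) 1, Metric.closedBall (w + t • (q - w)) (6 * σ) ⊆ Ω := by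
    intro q w hwv hqw t ht
    refine subset_trans (Metric.closedBall_subset_closedBall' ?_) hball
    rw [dist_eq_norm]
    have e1 : w + t • (q - w) - v = (w - v) + t • (q - w) := by abel
    have e2 : ‖t • (q - w)‖ ≤ T + m + 1 := by
      rw [norm_smul, Real.norm_of_nonneg ht.1]
      nlinarith [ht.2, norm_nonneg (q - w)]
    rw [e1]
    linarith [norm_add_le (w - v) (t • (q - w))]
  have hne1 := HC u (Ω ∩ U) K σ (2 * (1 + κ) * a) x p H hσ (by positivity)
    (by linarith) (fun t ht => subset_inter
      (hseg p x (by rw [norm_sub_rev]; linarith) (by linarith) t ht) (hs1 t ht))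
    ⟨x, hx, Metric.mem_closedBall_self hσ.le⟩
  have hne2 := HC u (Ω ∩ U) K σ (C * (2 * (1 + κ) * a)) p v H hσ (by positivity)
    (by linarith) (fun t ht => subset_inter
      (hseg v p (by rw [norm_sub_rev]; linarith) (by linarith) t ht) (hs2 t ht)) hne1
  have e : C * (C * (2 * (1 + κ) * a)) = C * (C * (2 * (1 + κ))) * a := by ring
  rwa [e] at hne2

/-- At large scales, a solution with values in `[0, 1]` cannot come close to both bounds. -/
theorem exists_not_near_both_bounds [MeasurableSpace V] [BorelSpace V] {L κ m σ M : ℝ} (hL : 1 ≤ L) (hκ : 0 ≤ κ) (hm : 0 ≤ m)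
    (hσ : 0 < σ) (hM : 0 ≤ M) :
    ∃ R₀ θ : ℝ, 1 ≤ R₀ ∧ 0 < θ ∧ θ ≤ 1 / 2 ∧ ∀ (u ω : V → ℝ) (U S : Set V) (x₀ : V) (R : ℝ),
      R₀ ≤ R → IsCorrector ω S κ m → S ⊆ U → JoinedInside U S σ M →
      ContinuousOn u (Metric.closedBall x₀ (100 * R)) →
      (∀ w ∈ Metric.closedBall x₀ (100 * R), 0 ≤ u w) →
      (∀ w ∈ Metric.closedBall x₀ (100 * R), u w ≤ 1) →
      SuperTest u U (Metric.ball x₀ (100 * R)) L →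
      SuperTest (fun x => 1 - u x) U (Metric.ball x₀ (100 * R)) L →
      ∀ y₁ ∈ Metric.closedBall x₀ R, ∀ y₂ ∈ Metric.closedBall x₀ R, u y₁ ≤ θ → θ < 1 - u y₂ := by
  have hLκ : 1 ≤ L * (1 + κ) := by nlinarith
  obtain ⟨CA, cA, hCA, hcA, HA⟩ := exists_touchSet_close (V := V) hLκ hκ
  -- A fixed scale, independent of `R`, large enough for the meeting lemma with corrector.
  obtain ⟨δ, hδ⟩ : ∃ δ, δ = m / cA + 1 := ⟨_, rfl⟩
  have hδ1 : 1 ≤ δ := by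
    have : 0 ≤ m / cA := by positivity
    linarith
  have hmδ : m ≤ cA * δ ^ 2 := by
    have h1 : m = cA * (m / cA) := by field_simp
    have h2 : m / cA ≤ δ ^ 2 := by nlinarith
    rw [h1]; gcongr
  obtain ⟨T, hT⟩ : ∃ T, T = M + δ := ⟨_, rfl⟩
  obtain ⟨CW, hCW, HW⟩ := exists_touchSet_near_center (V := V) (m := m) (T := T) hL hκ hσ
  obtain ⟨CB, cB, hCB, hcB, HB⟩ := exists_touchSet_close (V := V) hL (le_refl 0)
  have hCtot : 1 ≤ CB * (CW * CA) := by
    have : 1 ≤ CW * CA := by nlinarith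
    nlinarith
  obtain ⟨R₀, hR₀⟩ : ∃ R₀, R₀ = 4 * (T + m + 1) + 30 * σ := ⟨_, rfl⟩
  refine ⟨R₀, 1 / (10000 * (CB * (CW * CA))), by linarith, by positivity, ?_, ?_⟩
  · rw [div_le_div_iff₀ (by positivity) (by norm_num)]; linarith
  obtain ⟨θ, hθ⟩ : ∃ θ, θ = 1 / (10000 * (CB * (CW * CA))) := ⟨_, rfl⟩
  have hθC : CB * (CW * CA) * θ = 1 / 10000 := by rw [hθ]; field_simp
  have hθ0 : 0 < θ := by rw [hθ]; positivity
  have hθ1 : θ ≤ 1 / 100 := by nlinarith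
  rw [← hθ]
  intro u ω U S x₀ R hR hω hSU hjoin hu hu0 hu1 hs1 hs2 y₁ hy₁ y₂ hy₂ hy₁θ
  by_contra hcon
  push Not at hcon
  have hR0 : 0 < R := by linarith
  have hK : IsCompact (Metric.closedBall x₀ (100 * R)) := isCompact_closedBall _ _
  have hu' : ContinuousOn (fun x => 1 - u x) (Metric.closedBall x₀ (100 * R)) := by fun_prop
  have hΩ : Metric.ball x₀ (100 * R) ⊆ Metric.closedBall x₀ (100 * R) := Metric.ball_subset_closedBall
  have hΩo : IsOpen (Metric.ball x₀ (100 * R)) := Metric.isOpen_ball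
  have hu0' : ∀ w ∈ Metric.closedBall x₀ (100 * R), 0 ≤ 1 - u w := fun w hw => by
    linarith [hu1 w hw]
  have hu1' : ∀ w ∈ Metric.closedBall x₀ (100 * R), 1 - u w ≤ 1 := fun w hw => by
    linarith [hu0 w hw]
  have hne1 := exists_mem_touchSet_of_le hR0 hθ0 hK hu hu0 hy₁ hy₁θ
  have hne2 := exists_mem_touchSet_of_le hR0 hθ0 hK hu' hu0' hy₂ hcon
  have ha : 0 < θ / R ^ 2 := by positivity
  obtain ⟨x, hx, z₁, hz₁, z₂, hz₂, hd₁, hd₂⟩ := HA u (fun x => 1 - u x) ω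
    (Metric.ball x₀ (100 * R)) (Metric.closedBall x₀ (100 * R)) m (θ / R ^ 2) (3 * R) δ x₀
    (hs1.slideSetup hω hSU hL hK hu hΩ) (hs2.slideSetup hω hSU hL hK hu' hΩ) ha (by positivity)
    (by positivity) hmδ (Metric.closedBall_subset_ball (by linarith)) hne1 hne2
  obtain ⟨v, hvx, hvU, hvj⟩ := hjoin x
  have hvx₀ : dist v x₀ ≤ 3 * R + M := by
    rw [← dist_eq_norm] at hvx
    rw [Metric.mem_ball] at hx
    linarith [dist_triangle v x x₀]
  have hvz : ∀ z, dist x z < δ → ‖v - z‖ ≤ T := by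
    intro z hz
    rw [← dist_eq_norm] at hvx ⊢
    linarith [dist_triangle v x z]
  have hvb : Metric.closedBall v (3 * (T + m + 1) + 6 * σ) ⊆ Metric.ball x₀ (100 * R) := by
    intro w hw
    rw [Metric.mem_closedBall] at hw
    rw [Metric.mem_ball]
    linarith [dist_triangle w v x₀]
  have ha' : 0 < CA * (θ / R ^ 2) := by positivity
  have hn1 := HW u ω U S _ _ (CA * (θ / R ^ 2)) z₁ v hs1 hω hSU hK hu hΩ hΩo ha' hz₁.1
    (hvz _ hd₁) hvb hvj
  have hn2 := HW _ ω U S _ _ (CA * (θ / R ^ 2)) z₂ v hs2 hω hSU hK hu' hΩ hΩo ha' hz₂.1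
    (hvz _ hd₂) hvb hvj
  have hcb : Metric.closedBall v σ ⊆ Metric.ball v (2 * σ) :=
    Metric.closedBall_subset_ball (by linarith)
  have hv4 : Metric.ball v (2 * σ) ⊆ Metric.ball x₀ (4 * R) := by
    refine Metric.ball_subset_ball' ?_
    linarith
  have haR : CB * (CW * (CA * (θ / R ^ 2))) * R ^ 2 ≤ 1 / 10000 := by
    rw [← hθC]
    apply le_of_eq
    field_simp
  -- Both functions are now touched near `v`, in a ball inside `U`, where `ω = 0` and hence any
  -- scale `δ'` is allowed.
  have hsmall : ∀ δ' : ℝ, 0 < δ' → ∃ w₁ ∈ Metric.closedBall x₀ (100 * R),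
      ∃ w₂ ∈ Metric.closedBall x₀ (100 * R), dist w₁ w₂ < 2 * δ' ∧ u w₁ ≤ 1 / 4 ∧
      1 - u w₂ ≤ 1 / 4 := by
    intro δ' hδ'
    obtain ⟨q, hq, w₁, hw₁, w₂, hw₂, he₁, he₂⟩ := HB u (fun x => 1 - u x) 0
      (Metric.ball x₀ (100 * R) ∩ U) (Metric.closedBall x₀ (100 * R)) 0
      (CW * (CA * (θ / R ^ 2))) (2 * σ) δ' v
      (hs1.slideSetup_zero hL hK hu hΩ) (hs2.slideSetup_zero hL hK hu' hΩ) (by positivity)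
      (by positivity) hδ' (by positivity)
      (subset_inter (subset_trans (Metric.closedBall_subset_ball' (by linarith)) subset_rfl)
        (by convert hvU using 2; ring))
      (hn1.mono (inter_subset_inter_right _ hcb)) (hn2.mono (inter_subset_inter_right _ hcb))
    refine ⟨w₁, hw₁.1.1, w₂, hw₂.1.1, ?_, ?_, ?_⟩
    · rw [dist_comm] at he₁
      linarith [dist_triangle w₁ q w₂]
    · exact le_of_mem_touchSet hR0 (by positivity) hθ1 haR hu0 hu1 hy₁ hy₁θ (hv4 hw₁.2) hw₁.1
    · exact le_of_mem_touchSet (u := fun x => 1 - u x) hR0 (by positivity) hθ1 haR hu0' hu1' hy₂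
        hcon (hv4 hw₂.2) hw₂.1
  obtain ⟨η, hη, Hη⟩ := Metric.uniformContinuousOn_iff.1
    (hK.uniformContinuousOn_of_continuous hu) (1 / 2) (by norm_num)
  obtain ⟨w₁, hw₁, w₂, hw₂, hd, h1, h2⟩ := hsmall (η / 2) (by positivity)
  have h3 := Hη w₁ hw₁ w₂ hw₂ (by linarith)
  rw [Real.dist_eq] at h3
  have := (abs_lt.1 h3).1
  linarith

end Decay

/-! ### Oscillation decay and the large-scale Hölder bound -/

section Hoelder

variable {V : Type*} [NormedAddCommGroup V] [InnerProductSpace ℝ V]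
  {u ω : V → ℝ} {U S Ω Ω' : Set V} {L κ m σ M : ℝ}

theorem SuperTest.mono (h : SuperTest u U Ω L) (hΩ : Ω' ⊆ Ω) : SuperTest u U Ω' L where
  degenerate x₀ hx₀ := h.degenerate x₀ (hΩ hx₀)
  elliptic x₀ hx₀ := h.elliptic x₀ ⟨hΩ hx₀.1, hx₀.2⟩

theorem SuperTest.affine (h : SuperTest u U Ω L) {c : ℝ} (hc : 0 < c) (k : ℝ) :
    SuperTest (fun x => c * u x + k) U Ω L where
  degenerate x₀ hx₀ p β hβ hev := by
    refine h.degenerate x₀ hx₀ (c⁻¹ • p) (c⁻¹ * β) (by positivity) ?_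
    filter_upwards [hev] with x hx
    rw [real_inner_smul_left]
    refine le_of_mul_le_mul_left ?_ hc
    calc _ = c * u x₀ + inner ℝ p (x - x₀) + β * ‖x - x₀‖ ^ 2 := by field_simp
      _ ≤ _ := by linarith
  elliptic x₀ hx₀ p e he α β hα hβ hev := by
    have := h.elliptic x₀ hx₀ (c⁻¹ • p) e he (c⁻¹ * α) (c⁻¹ * β) (by positivity) (by positivity) (by
      filter_upwards [hev] with x hx
      rw [real_inner_smul_left]
      simp only [Pi.zero_apply, sub_self, mul_zero, add_zero] at hx ⊢
      refine le_of_mul_le_mul_left ?_ hc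
      calc _ = c * u x₀ + inner ℝ p (x - x₀) + α * inner ℝ e (x - x₀) ^ 2
              - β * ‖x - x₀‖ ^ 2 := by field_simp
        _ ≤ _ := by linarith)
    refine le_of_mul_le_mul_left (a := c⁻¹) ?_ (by positivity)
    linarith

variable [FiniteDimensional ℝ V] [MeasurableSpace V] [BorelSpace V]

/-- Decay of the oscillation at large scales. -/
theorem exists_osc_decay (hL : 1 ≤ L) (hκ : 0 ≤ κ) (hm : 0 ≤ m) (hσ : 0 < σ) (hM : 0 ≤ M) :
    ∃ R₀ θ : ℝ, 1 ≤ R₀ ∧ 0 < θ ∧ θ ≤ 1 / 2 ∧ ∀ (u ω : V → ℝ) (U S : Set V) (x₀ : V) (R o : ℝ),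
      R₀ ≤ R → 0 < o → IsCorrector ω S κ m → S ⊆ U → JoinedInside U S σ M →
      ContinuousOn u (Metric.closedBall x₀ (100 * R)) →
      SuperTest u U (Metric.ball x₀ (100 * R)) L →
      SuperTest (fun x => -u x) U (Metric.ball x₀ (100 * R)) L →
      (∀ x ∈ Metric.closedBall x₀ (100 * R), ∀ y ∈ Metric.closedBall x₀ (100 * R),
        |u x - u y| ≤ o) →
      ∀ x ∈ Metric.closedBall x₀ R, ∀ y ∈ Metric.closedBall x₀ R, |u x - u y| ≤ (1 - θ) * o := by
  obtain ⟨R₀, θ, hR₀, hθ, hθ2, H⟩ := exists_not_near_both_bounds (V := V) hL hκ hm hσ hM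
  refine ⟨R₀, θ, hR₀, hθ, hθ2, ?_⟩
  intro u ω U S x₀ R o hR ho hω hSU hj hu h1 h2 hosc
  have hR0 : 0 < R := by linarith
  obtain ⟨w₀, hw₀, hmin⟩ := (isCompact_closedBall x₀ (100 * R)).exists_isMinOn
    ⟨x₀, Metric.mem_closedBall_self (by positivity)⟩ hu
  obtain ⟨f, hf⟩ : ∃ f : V → ℝ, f = fun x => o⁻¹ * u x + (-(o⁻¹ * u w₀)) := ⟨_, rfl⟩
  have hfo : ∀ x, o * f x = u x - u w₀ := by
    intro x; rw [hf]; field_simp; ring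
  have hf0 : ∀ w ∈ Metric.closedBall x₀ (100 * R), 0 ≤ f w := by
    intro w hw
    have h3 : u w₀ ≤ u w := hmin hw
    refine le_of_mul_le_mul_left (a := o) ?_ ho
    rw [hfo]; linarith
  have hf1 : ∀ w ∈ Metric.closedBall x₀ (100 * R), f w ≤ 1 := by
    intro w hw
    have h3 := (abs_le.1 (hosc w hw w₀ hw₀)).2
    refine le_of_mul_le_mul_left (a := o) ?_ ho
    rw [hfo]; linarith
  have hs1 : SuperTest f U (Metric.ball x₀ (100 * R)) L := by
    rw [hf]; exact h1.affine (by positivity) _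
  have hs2 : SuperTest (fun x => 1 - f x) U (Metric.ball x₀ (100 * R)) L := by
    have := h2.affine (c := o⁻¹) (by positivity) (1 + o⁻¹ * u w₀)
    convert this using 2 with x
    rw [hf]; ring
  have hfc : ContinuousOn f (Metric.closedBall x₀ (100 * R)) := by
    rw [hf]; fun_prop
  have hsub : Metric.closedBall x₀ R ⊆ Metric.closedBall x₀ (100 * R) :=
    Metric.closedBall_subset_closedBall (by linarith)
  have key := H f ω U S x₀ R hR hω hSU hj hfc hf0 hf1 hs1 hs2
  have hfin : ∀ x ∈ Metric.closedBall x₀ R, ∀ y ∈ Metric.closedBall x₀ R,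
      f x - f y ≤ 1 - θ := by
    intro x hx y hy
    rcases le_or_gt (f y) θ with h3 | h3
    · linarith [key y hy x hx h3, hf0 y (hsub hy)]
    · linarith [hf1 x (hsub hx)]
  intro x hx y hy
  have e1 : u x - u y = o * (f x - f y) := by rw [mul_sub, hfo, hfo]; ring
  rw [e1, abs_mul, abs_of_pos ho, mul_comm]
  have : |f x - f y| ≤ 1 - θ := by
    rw [abs_le]
    constructor <;> linarith [hfin x hx y hy, hfin y hy x hx]
  gcongr

/-- Hölder continuity at unit scale and above. -/
theorem exists_hoelder_large_scale (hL : 1 ≤ L) (hκ : 0 ≤ κ) (hm : 0 ≤ m) (hσ : 0 < σ)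
    (hM : 0 ≤ M) :
    ∃ C γ : ℝ, 0 < C ∧ 0 < γ ∧ γ < 1 ∧ ∀ (u ω : V → ℝ) (U S : Set V) (x₀ : V) (R : ℝ),
      0 < R → IsCorrector ω S κ m → S ⊆ U → JoinedInside U S σ M →
      ContinuousOn u (Metric.closedBall x₀ R) →
      SuperTest u U (Metric.ball x₀ R) L →
      SuperTest (fun x => -u x) U (Metric.ball x₀ R) L →
      ∀ y, 1 ≤ dist x₀ y → (∀ x ∈ Metric.closedBall x₀ R, |u x| ≤ 1) → |u y| ≤ 1 →
        |u x₀ - u y| ≤ C * (dist x₀ y / R) ^ γ := by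
  obtain ⟨R₀, θ, hR₀, hθ, hθ2, H⟩ := exists_osc_decay (V := V) hL hκ hm hσ hM
  have hlog : 0 < Real.log 100 := Real.log_pos (by norm_num)
  have hlogθ : Real.log (1 - θ) < 0 := Real.log_neg (by linarith) (by linarith)
  -- The exponent solves `100 ^ (-γ) = 1 - θ`; it is below 1 because `1 - θ ≥ 1/2 > 1/100`.
  obtain ⟨γ, hγ⟩ : ∃ γ, γ = -Real.log (1 - θ) / Real.log 100 := ⟨_, rfl⟩
  have hγ0 : 0 < γ := by rw [hγ]; exact div_pos (by linarith) hlog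
  have hγ1 : γ < 1 := by
    rw [hγ, div_lt_one hlog, neg_lt, ← Real.log_inv]
    apply Real.log_lt_log (by norm_num)
    have : (100 : ℝ)⁻¹ < 1 / 2 := by norm_num
    linarith
  have h100 : (100 : ℝ) ^ (-γ) = 1 - θ := by
    rw [Real.rpow_def_of_pos (by norm_num), hγ]
    have : Real.log 100 * -(-Real.log (1 - θ) / Real.log 100) = Real.log (1 - θ) := by
      field_simp
    rw [this, Real.exp_log (by linarith)]
  refine ⟨2 * (100 * R₀) ^ γ, γ, by positivity, hγ0, hγ1, ?_⟩
  intro u ω U S x₀ R hR hω hSU hj hu h1 h2 y hy hb hby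
  obtain ⟨D, hD⟩ : ∃ D, D = dist x₀ y := ⟨_, rfl⟩
  rw [← hD] at hy ⊢
  have hD0 : 0 < D := by linarith
  have hgoal : 2 * (100 * R₀) ^ γ * (D / R) ^ γ = 2 * (100 * (R₀ * D / R)) ^ γ := by
    rw [mul_assoc, ← Real.mul_rpow (by positivity) (by positivity)]
    congr 2; ring
  rw [hgoal]
  have hx₀ : |u x₀| ≤ 1 := hb x₀ (Metric.mem_closedBall_self hR.le)
  -- If `R < R₀ D` the right-hand side is at least 2 and the bound is trivial.
  rcases lt_or_ge R (R₀ * D) with hlt | hge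
  · have h3 : 1 ≤ 100 * (R₀ * D / R) := by
      have : 1 ≤ R₀ * D / R := by rw [le_div_iff₀ hR]; linarith
      linarith
    have h4 := Real.one_le_rpow h3 hγ0.le
    linarith [abs_sub (u x₀) (u y)]
  obtain ⟨j, hj1, hj2⟩ := exists_nat_pow_near (x := R / (R₀ * D)) (y := (100 : ℝ))
    (by rw [le_div_iff₀ (by positivity)]; linarith) (by norm_num)
  have hosc : ∀ i : ℕ, R₀ ≤ R / 100 ^ i → ∀ x ∈ Metric.closedBall x₀ (R / 100 ^ i),
      ∀ y ∈ Metric.closedBall x₀ (R / 100 ^ i), |u x - u y| ≤ 2 * (1 - θ) ^ i := by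
    intro i
    induction i with
    | zero =>
      intro _ x hx y hy
      simp only [pow_zero, div_one, mul_one] at hx hy ⊢
      linarith [abs_sub (u x) (u y), hb x hx, hb y hy]
    | succ i ih =>
      intro hi
      have e1 : 100 * (R / 100 ^ (i + 1)) = R / 100 ^ i := by field_simp; ring
      have hle : R / 100 ^ i ≤ R := div_le_self hR.le (one_le_pow₀ (by norm_num))
      have h3 : R₀ ≤ R / 100 ^ i := by rw [← e1]; linarith
      have h4 := H u ω U S x₀ (R / 100 ^ (i + 1)) (2 * (1 - θ) ^ i) hi
        (by have : 0 < 1 - θ := by linarith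
            positivity) hω hSU hj
        (by rw [e1]; exact hu.mono (Metric.closedBall_subset_closedBall hle))
        (by rw [e1]; exact h1.mono (Metric.ball_subset_ball hle))
        (by rw [e1]; exact h2.mono (Metric.ball_subset_ball hle))
        (by rw [e1]; exact ih h3)
      have e2 : (1 - θ) * (2 * (1 - θ) ^ i) = 2 * (1 - θ) ^ (i + 1) := by ring
      rw [e2] at h4
      exact h4
  have hRj : R₀ * D ≤ R / 100 ^ j := by
    rw [le_div_iff₀ (by positivity)] at hj1 ⊢
    linarith
  have h3 := hosc j (by nlinarith) x₀ (Metric.mem_closedBall_self (by positivity)) y (by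
    rw [Metric.mem_closedBall, dist_comm, ← hD]; nlinarith)
  refine h3.trans ?_
  have h4 : (1 - θ) ^ j = ((100 : ℝ) ^ j)⁻¹ ^ γ := by
    rw [← h100, ← Real.rpow_natCast, ← Real.rpow_mul (by norm_num), ← Real.rpow_natCast,
      ← Real.rpow_neg (by norm_num), ← Real.rpow_mul (by norm_num)]
    congr 1; ring
  rw [h4]
  gcongr
  rw [inv_le_iff_one_le_mul₀ (by positivity)]
  rw [div_lt_iff₀ (by positivity)] at hj2
  rw [mul_comm, ← mul_assoc, mul_div_assoc', le_div_iff₀ hR]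
  rw [pow_succ] at hj2
  linarith

end Hoelder

/-! ### The one-dimensional corrector -/

section OneDim

/-- A lower bound on the second derivative gives a quadratic lower bound. -/
theorem quadratic_le_of_le_deriv2 {I : Set ℝ} (hI : Convex ℝ I) {g g' g'' : ℝ → ℝ}
    (hg : ∀ t, HasDerivAt g (g' t) t) (hg' : ∀ t, HasDerivAt g' (g'' t) t) {c : ℝ}
    (hc : ∀ t ∈ I, 2 * c ≤ g'' t) {s t : ℝ} (hs : s ∈ I) (ht : t ∈ I) :
    g s + g' s * (t - s) + c * (t - s) ^ 2 ≤ g t := by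
  have hF : ∀ w, HasDerivAt (fun w => g w - g' s * (w - s) - c * (w - s) ^ 2)
      (g' w - g' s - c * (2 * (w - s))) w := by
    intro w
    have h1 : HasDerivAt (fun w : ℝ => w - s) 1 w := (hasDerivAt_id w).sub_const s
    have h2 := ((hg w).sub (h1.const_mul (g' s))).sub ((h1.pow 2).const_mul c)
    exact h2.congr_deriv (by norm_num)
  have hF' : ∀ w, HasDerivAt (fun w => g' w - g' s - c * (2 * (w - s))) (g'' w - c * 2) w := by
    intro w
    have h1 : HasDerivAt (fun w : ℝ => w - s) 1 w := (hasDerivAt_id w).sub_const s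
    have h2 := ((hg' w).sub_const (g' s)).sub ((h1.const_mul 2).const_mul c)
    exact h2.congr_deriv (by norm_num)
  have hmono : MonotoneOn (fun w => g' w - g' s - c * (2 * (w - s))) I := by
    refine monotoneOn_of_deriv_nonneg hI (fun w _ => (hF' w).continuousAt.continuousWithinAt)
      (fun w _ => (hF' w).differentiableAt.differentiableWithinAt) fun w hw => ?_
    rw [(hF' w).deriv]
    linarith [hc w (interior_subset hw)]
  have hzero : g' s - g' s - c * (2 * (s - s)) = 0 := by ring
  suffices h : g s - g' s * (s - s) - c * (s - s) ^ 2 ≤ g t - g' s * (t - s) - c * (t - s) ^ 2 by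
    simp only [sub_self, mul_zero, sub_zero, ne_eq, OfNat.ofNat_ne_zero, not_false_eq_true,
      zero_pow] at h
    linarith
  rcases le_total s t with hst | hst
  · have hsub : Icc s t ⊆ I := fun w hw => hI.ordConnected.out hs ht hw
    refine (monotoneOn_of_deriv_nonneg (convex_Icc s t)
      (fun w _ => (hF w).continuousAt.continuousWithinAt)
      (fun w _ => (hF w).differentiableAt.differentiableWithinAt) fun w hw => ?_)
      (left_mem_Icc.2 hst) (right_mem_Icc.2 hst) hst
    rw [(hF w).deriv, ← hzero]
    have hw' := interior_subset hw
    exact hmono hs (hsub hw') hw'.1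
  · have hsub : Icc t s ⊆ I := fun w hw => hI.ordConnected.out ht hs hw
    refine (antitoneOn_of_deriv_nonpos (convex_Icc t s)
      (fun w _ => (hF w).continuousAt.continuousWithinAt)
      (fun w _ => (hF w).differentiableAt.differentiableWithinAt) fun w hw => ?_)
      (left_mem_Icc.2 hst) (right_mem_Icc.2 hst) hst
    rw [(hF w).deriv, ← hzero]
    have hw' := interior_subset hw
    exact hmono (hsub hw') hs hw'.2

theorem cos_two_pi_mul_ge {η t : ℝ} (hη : 0 < η) (ht : ∀ k : ℤ, η ≤ |t - (k + 1 / 2)|) :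
    -Real.cos (2 * Real.pi * η) ≤ Real.cos (2 * Real.pi * t) := by
  obtain ⟨w, hw⟩ : ∃ w, w = t - (round (t - 1 / 2) + 1 / 2 : ℝ) := ⟨_, rfl⟩
  have h1 : |w| ≤ 1 / 2 := by
    have := abs_sub_round (t - 1 / 2)
    have e : w = t - 1 / 2 - round (t - 1 / 2) := by rw [hw]; ring
    rw [e]; exact this
  have h2 : η ≤ |w| := by rw [hw]; exact ht _
  have h3 : Real.cos (2 * Real.pi * t) = -Real.cos (2 * Real.pi * |w|) := by
    have e1 : 2 * Real.pi * t = (2 * Real.pi * w + Real.pi) +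
        (round (t - 1 / 2) : ℤ) * (2 * Real.pi) := by rw [hw]; ring
    rw [e1, Real.cos_add_int_mul_two_pi, Real.cos_add_pi]
    congr 1
    rw [← Real.cos_abs, abs_mul, abs_of_pos (by positivity : 0 < 2 * Real.pi)]
  rw [h3, neg_le_neg_iff]
  apply Real.cos_le_cos_of_nonneg_of_le_pi
  · positivity
  · nlinarith [Real.pi_pos]
  · have := Real.pi_pos
    gcongr

/-- A bounded function on the line with second derivative bounded from below, that is uniformly
convex away from the half-integers. -/
theorem exists_corrector_one_dim {η : ℝ} (hη : 0 < η) (hη4 : η < 1 / 4) :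
    ∃ (g : ℝ → ℝ) (κ m : ℝ), Continuous g ∧ 0 ≤ κ ∧ 0 ≤ m ∧ (∀ t, 0 ≤ g t) ∧ (∀ t, g t ≤ m) ∧
      (∀ s, ∃ p, ∀ t, g s + p * (t - s) - κ * (t - s) ^ 2 ≤ g t) ∧
      ∀ s : ℝ, (∀ k : ℤ, η ≤ |s - (k + 1 / 2)|) →
        ∃ p, ∀ᶠ t in 𝓝 s, g s + p * (t - s) + 2 * (t - s) ^ 2 ≤ g t := by
  have hpi := Real.pi_pos
  have hpi3 := Real.pi_gt_three
  obtain ⟨b, hb⟩ : ∃ b, b = Real.cos (2 * Real.pi * η) := ⟨_, rfl⟩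
  have hb0 : 0 < b := by
    rw [hb]
    apply Real.cos_pos_of_mem_Ioo
    constructor <;> nlinarith
  have hb1 : b < 1 := by
    rw [hb, ← Real.cos_zero]
    apply Real.cos_lt_cos_of_nonneg_of_le_pi <;> nlinarith
  -- The second derivative of `-log (c + cos)` is `(1 + c cos)/(c + cos)²`. Any `c > 1` keeps the
  -- logarithm smooth, and `c < 1/b` makes the quotient positive where `cos ≥ -b`; `c` is the
  -- midpoint, and `A` normalizes the convexity.
  obtain ⟨c, hc⟩ : ∃ c, c = (1 + 1 / b) / 2 := ⟨_, rfl⟩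
  have hcb : c * b = (1 + b) / 2 := by rw [hc]; field_simp; ring
  have hc1 : 1 < c := by nlinarith
  obtain ⟨A, hA⟩ : ∃ A, A = (c + 1) ^ 2 / (1 - b) := ⟨_, rfl⟩
  have h1b : 0 < 1 - b := by linarith
  have hA0 : 0 < A := by rw [hA]; positivity
  have hpos : ∀ t, 0 < c + Real.cos t := fun t => by linarith [Real.neg_one_le_cos t]
  let g : ℝ → ℝ := fun t => A * (Real.log (c + 1) - Real.log (c + Real.cos (2 * Real.pi * t)))
  let g' : ℝ → ℝ := fun t =>
    2 * Real.pi * A * (Real.sin (2 * Real.pi * t) / (c + Real.cos (2 * Real.pi * t)))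
  let g'' : ℝ → ℝ := fun t => 4 * Real.pi ^ 2 * A *
    ((1 + c * Real.cos (2 * Real.pi * t)) / (c + Real.cos (2 * Real.pi * t)) ^ 2)
  have hlin : ∀ t, HasDerivAt (fun t : ℝ => 2 * Real.pi * t) (2 * Real.pi) t := fun t => by
    simpa using (hasDerivAt_id t).const_mul (2 * Real.pi)
  have hcos : ∀ t, HasDerivAt (fun t : ℝ => c + Real.cos (2 * Real.pi * t))
      (-Real.sin (2 * Real.pi * t) * (2 * Real.pi)) t := fun t => (hlin t).cos.const_add c
  have hg : ∀ t, HasDerivAt g (g' t) t := by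
    intro t
    have h1 := (((hcos t).log (hpos _).ne').const_sub (Real.log (c + 1))).const_mul A
    have := (hpos (2 * Real.pi * t)).ne'
    refine h1.congr_deriv ?_
    simp only [g']
    field_simp
  have hg' : ∀ t, HasDerivAt g' (g'' t) t := by
    intro t
    have h1 := (((hlin t).sin.div (hcos t) (hpos _).ne')).const_mul (2 * Real.pi * A)
    refine h1.congr_deriv ?_
    simp only [g'']
    have hsc := Real.sin_sq_add_cos_sq (2 * Real.pi * t)
    have e : Real.cos (2 * Real.pi * t) * (2 * Real.pi) * (c + Real.cos (2 * Real.pi * t)) -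
        Real.sin (2 * Real.pi * t) * (-Real.sin (2 * Real.pi * t) * (2 * Real.pi)) =
        2 * Real.pi * (1 + c * Real.cos (2 * Real.pi * t)) := by
      linear_combination (2 * Real.pi) * hsc
    rw [e]; ring
  have hgcont : Continuous g := continuous_iff_continuousAt.2 fun t => (hg t).continuousAt
  have hg''c : Continuous g'' := by
    have : ∀ t, (c + Real.cos (2 * Real.pi * t)) ^ 2 ≠ 0 := fun t => (pow_pos (hpos _) 2).ne'
    simp only [g'']
    fun_prop (disch := assumption)
  have hlog : Real.log (c - 1) ≤ Real.log (c + 1) :=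
    Real.log_le_log (by linarith) (by linarith)
  refine ⟨g, 2 * Real.pi ^ 2 * A / (c - 1), A * (Real.log (c + 1) - Real.log (c - 1)), hgcont,
    ?_, ?_, ?_, ?_, ?_, ?_⟩
  · have : 0 < c - 1 := by linarith
    positivity
  · exact mul_nonneg hA0.le (by linarith)
  · intro t
    refine mul_nonneg hA0.le (sub_nonneg.2 (Real.log_le_log (hpos _) ?_))
    linarith [Real.cos_le_one (2 * Real.pi * t)]
  · intro t
    refine mul_le_mul_of_nonneg_left (sub_le_sub_left (Real.log_le_log (by linarith) ?_) _) hA0.le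
    linarith [Real.neg_one_le_cos (2 * Real.pi * t)]
  · intro s
    refine ⟨g' s, fun t => ?_⟩
    have h1 := quadratic_le_of_le_deriv2 convex_univ hg hg'
      (c := -(2 * Real.pi ^ 2 * A / (c - 1))) (fun w _ => ?_) (mem_univ s) (mem_univ t)
    · linarith
    · have hc1' : 0 < c - 1 := by linarith
      have h2 := hpos (2 * Real.pi * w)
      have h3 := Real.neg_one_le_cos (2 * Real.pi * w)
      have h4 : -(1 / (c - 1)) ≤ (1 + c * Real.cos (2 * Real.pi * w)) /
          (c + Real.cos (2 * Real.pi * w)) ^ 2 := by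
        rw [le_div_iff₀ (by positivity), neg_mul, one_div_mul_eq_div, neg_le, le_div_iff₀ hc1']
        have h5 : (c - 1) ^ 2 ≤ (c + Real.cos (2 * Real.pi * w)) ^ 2 := by
          apply pow_le_pow_left₀ <;> linarith
        have h6 : -(1 + c * Real.cos (2 * Real.pi * w)) ≤ c - 1 := by nlinarith
        nlinarith
      have h5 := mul_le_mul_of_nonneg_left h4 (by positivity : 0 ≤ 4 * Real.pi ^ 2 * A)
      calc _ = 4 * Real.pi ^ 2 * A * -(1 / (c - 1)) := by ring
        _ ≤ _ := h5
  · intro s hs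
    have h1 := cos_two_pi_mul_ge hη hs
    rw [← hb] at h1
    have h2 : 4 < g'' s := by
      have h3 : (1 - b) / 2 ≤ 1 + c * Real.cos (2 * Real.pi * s) := by nlinarith
      have h4 : (c + Real.cos (2 * Real.pi * s)) ^ 2 ≤ (c + 1) ^ 2 := by
        have := Real.cos_le_one (2 * Real.pi * s)
        have := hpos (2 * Real.pi * s)
        gcongr
      have h5 : ((1 - b) / 2) / (c + 1) ^ 2 ≤ (1 + c * Real.cos (2 * Real.pi * s)) /
          (c + Real.cos (2 * Real.pi * s)) ^ 2 :=
        div_le_div₀ (by linarith) h3 (pow_pos (hpos _) 2) h4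
      have h6 : A * (((1 - b) / 2) / (c + 1) ^ 2) = 1 / 2 := by rw [hA]; field_simp
      have h7 := mul_le_mul_of_nonneg_left h5 (by positivity : 0 ≤ 4 * Real.pi ^ 2 * A)
      simp only [g'']
      nlinarith
    obtain ⟨r, hr, hball⟩ := Metric.eventually_nhds_iff_ball.1
      (hg''c.continuousAt.eventually (Ioi_mem_nhds h2))
    refine ⟨g' s, ?_⟩
    filter_upwards [Metric.ball_mem_nhds s hr] with t ht
    refine quadratic_le_of_le_deriv2 (convex_ball s r) hg hg' (fun w hw => ?_)
      (Metric.mem_ball_self hr) ht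
    have := hball w hw
    linarith

end OneDim

/-! ### The frame of cube faces: corrector and connectedness -/

section Frame

/-- The points with a coordinate at distance less than `η` from the half-integers. -/
def frameNhd (n : ℕ) (η : ℝ) : Set (EuclideanSpace ℝ (Fin n)) :=
  {x | ∃ i, ∃ k : ℤ, |x i - (k + 1 / 2)| < η}

variable {n : ℕ}

/-- The sum of the one-dimensional correctors of the coordinates: off the frame every coordinate is
far from the half-integers, so every summand is uniformly convex. -/
theorem exists_isCorrector (n : ℕ) {η : ℝ} (hη : 0 < η) (hη4 : η < 1 / 4) :
    ∃ (ω : EuclideanSpace ℝ (Fin n) → ℝ) (κ m : ℝ), IsCorrector ω (frameNhd n η) κ m := by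
  obtain ⟨g, κ, m, hg, hκ, hm, hg0, hgm, hsc, hcv⟩ := exists_corrector_one_dim hη hη4
  have hsum : ∀ (x x' : EuclideanSpace ℝ (Fin n)) (p : Fin n → ℝ) (c : ℝ),
      (∀ i, g (x i) + p i * (x' i - x i) + c * (x' i - x i) ^ 2 ≤ g (x' i)) →
      ∑ i, g (x i) + inner ℝ (WithLp.toLp 2 p) (x' - x) + c * ‖x' - x‖ ^ 2 ≤ ∑ i, g (x' i) := by
    intro x x' p c h
    rw [EuclideanSpace.norm_sq_eq, PiLp.inner_apply, Finset.mul_sum, ← Finset.sum_add_distrib,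
      ← Finset.sum_add_distrib]
    refine Finset.sum_le_sum fun i _ => ?_
    have := h i
    simp only [PiLp.sub_apply, Real.norm_eq_abs, sq_abs, RCLike.inner_apply, conj_trivial]
    linarith
  refine ⟨fun x => ∑ i, g (x i), κ, n * m, ?_, ?_, ?_, hκ, ?_, ?_⟩
  · fun_prop
  · exact fun x => Finset.sum_nonneg fun i _ => hg0 _
  · intro x
    calc ∑ i, g (x i) ≤ ∑ i : Fin n, m := Finset.sum_le_sum fun i _ => hgm _
      _ = n * m := by simp
  · intro x
    choose p hp using fun i => hsc (x i)
    refine ⟨WithLp.toLp 2 p, fun x' => ?_⟩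
    have := hsum x x' p (-κ) fun i => by linarith [hp i (x' i)]
    linarith
  · intro x hx
    simp only [frameNhd, mem_ofPred_eq, not_exists, not_lt] at hx
    choose p hp using fun i => hcv (x i) (hx i)
    refine ⟨WithLp.toLp 2 p, ?_⟩
    have hev : ∀ᶠ x' in 𝓝 x, ∀ i,
        g (x i) + p i * (x' i - x i) + 2 * (x' i - x i) ^ 2 ≤ g (x' i) := by
      rw [eventually_all]
      intro i
      have hc : Tendsto (fun x' : EuclideanSpace ℝ (Fin n) => x' i) (𝓝 x) (𝓝 (x i)) :=
        Continuous.tendsto (by fun_prop) x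
      exact hc.eventually (hp i)
    filter_upwards [hev] with x' hx'
    exact hsum x x' p 2 hx'

theorem abs_sub_apply_le_dist (x y : EuclideanSpace ℝ (Fin n)) (i : Fin n) :
    |x i - y i| ≤ dist x y := by
  rw [dist_eq_norm]
  exact PiLp.norm_apply_le (x - y) i

/-- The region where the rescaled equation is uniformly elliptic. -/
def ellipticRegion (n : ℕ) (d : ℝ) : Set (EuclideanSpace ℝ (Fin n)) :=
  {x | n = 1 ∨ x ∈ frameNhd n d}

theorem frameNhd_subset_ellipticRegion {η d : ℝ} (h : η ≤ d) :
    frameNhd n η ⊆ ellipticRegion n d := by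
  rintro x ⟨i, k, hk⟩
  exact Or.inr ⟨i, k, hk.trans_le h⟩

/-- The target `v` is the point with all coordinates half-integers in the integer cell of `x`. From
a point near a face `xᵢ = k + 1/2`, first move another coordinate `j` to `vⱼ`, staying near that
face; then go straight to `v` within the hyperplane where coordinate `j` equals `vⱼ`. -/
theorem joinedInside_ellipticRegion (hn0 : 0 < n) {d : ℝ} (hd : 0 < d) :
    JoinedInside (ellipticRegion n d) (frameNhd n (d / 2)) (d / 80) n := by
  intro x
  obtain ⟨v, hv⟩ : ∃ v : EuclideanSpace ℝ (Fin n), ∀ i, v i = ⌊x i⌋ + 1 / 2 :=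
    ⟨WithLp.toLp 2 fun i => ⌊x i⌋ + 1 / 2, fun i => rfl⟩
  have hclose : ∀ (w q : EuclideanSpace ℝ (Fin n)) (i : Fin n) (k : ℤ) (r : ℝ),
      |w i - (k + 1 / 2)| ≤ d / 2 → r < d / 2 → q ∈ Metric.closedBall w r →
      q ∈ ellipticRegion n d := by
    intro w q i k r hw hr hq
    refine Or.inr ⟨i, k, ?_⟩
    have h1 := abs_sub_apply_le_dist q w i
    rw [Metric.mem_closedBall] at hq
    have h2 := abs_sub_le (q i) (w i) (k + 1 / 2)
    linarith
  refine ⟨v, ?_, ?_, ?_⟩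
  · apply le_of_sq_le_sq _ (by positivity)
    rw [EuclideanSpace.norm_sq_eq]
    calc ∑ i, ‖(v - x) i‖ ^ 2 ≤ ∑ i : Fin n, (1 : ℝ) := by
          refine Finset.sum_le_sum fun i _ => ?_
          rw [PiLp.sub_apply, hv, Real.norm_eq_abs, sq_abs]
          nlinarith [Int.floor_le (x i), Int.lt_floor_add_one (x i)]
      _ = n := by simp
      _ ≤ (n : ℝ) ^ 2 := by exact_mod_cast Nat.le_self_pow two_ne_zero n
  · intro q hq
    exact hclose v q ⟨0, hn0⟩ ⌊x ⟨0, hn0⟩⌋ (20 * (d / 80))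
      (by rw [hv, sub_self, abs_zero]; positivity) (by linarith) hq
  · rintro x' ⟨i, k, hk⟩
    -- With a single coordinate there is no second direction to move in, but the elliptic region is
    -- the whole line.
    by_cases hn : n = 1
    · refine ⟨v, le_rfl, by simp, fun t _ q _ => Or.inl hn, fun t _ q _ => Or.inl hn⟩
    have hi := i.2
    obtain ⟨j, hj⟩ : ∃ j : Fin n, j ≠ i := by
      have : Nontrivial (Fin n) := Fin.nontrivial_iff_two_le.2 (by omega)
      exact exists_ne i
    have hp : ∀ l, (x' + EuclideanSpace.single j (v j - x' j)) l = if l = j then v j else x' l := by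
      intro l
      rw [PiLp.add_apply, PiLp.single_apply]
      split_ifs with h
      · rw [h]; ring
      · ring
    refine ⟨x' + EuclideanSpace.single j (v j - x' j), ?_, ?_, ?_, ?_⟩
    · rw [add_sub_cancel_left, PiLp.norm_single]
      exact PiLp.norm_apply_le (v - x') j
    · apply le_of_sq_le_sq _ (norm_nonneg _)
      rw [EuclideanSpace.norm_sq_eq, EuclideanSpace.norm_sq_eq]
      refine Finset.sum_le_sum fun l _ => ?_
      rw [PiLp.sub_apply, hp]
      split_ifs with h
      · rw [h, sub_self, norm_zero, zero_pow two_ne_zero]; positivity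
      · rfl
    · intro t _ q hq
      refine hclose _ q i k _ ?_ (by linarith) hq
      rw [add_sub_cancel_left, PiLp.add_apply, PiLp.smul_apply, PiLp.single_apply, if_neg hj.symm]
      simpa using hk.le
    · intro t _ q hq
      refine hclose _ q j ⌊x j⌋ _ ?_ (by linarith) hq
      rw [PiLp.add_apply, PiLp.smul_apply, PiLp.sub_apply, hp, if_pos rfl, sub_self, smul_zero,
        add_zero, hv, sub_self, abs_zero]
      positivity

end Frame

/-! ### From viscosity solutions to quadratic tests -/

section Viscosity

variable {n : ℕ}

/-- The Hessian of a quadratic polynomial. -/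
theorem secondPartial_quadratic (x₀ p e : EuclideanSpace ℝ (Fin n)) (c α β : ℝ) (i j : Fin n) :
    secondPartial (fun x => c + inner ℝ p (x - x₀) + α * inner ℝ e (x - x₀) ^ 2
      - β * ‖x - x₀‖ ^ 2) x₀ i j = 2 * α * (e i * e j) - 2 * β * (if i = j then 1 else 0) := by
  let T : EuclideanSpace ℝ (Fin n) →L[ℝ] EuclideanSpace ℝ (Fin n) →L[ℝ] ℝ :=
    LinearMap.toContinuousLinearMap
      { toFun := fun x => (2 * α * inner ℝ e x) • innerSL ℝ e - (2 * β) • innerSL ℝ x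
        map_add' := fun x y => by simp only [inner_add_right, map_add]; module
        map_smul' := fun r x => by
          ext v
          simp [real_inner_smul_right]
          ring }
  have hT : ∀ x v, T x v = 2 * α * inner ℝ e x * inner ℝ e v - 2 * β * inner ℝ x v :=
    fun x v => by simp [T]
  have h1 : fderiv ℝ (fun x => c + inner ℝ p (x - x₀) + α * inner ℝ e (x - x₀) ^ 2
      - β * ‖x - x₀‖ ^ 2) = fun x => innerSL ℝ p + T (x - x₀) := by
    funext x
    apply HasFDerivAt.fderiv
    have hsub : HasFDerivAt (fun x => x - x₀) (ContinuousLinearMap.id ℝ _) x :=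
      (hasFDerivAt_id x).sub_const x₀
    have hp : HasFDerivAt (fun x => inner ℝ p (x - x₀)) (innerSL ℝ p) x :=
      (innerSL ℝ p).hasFDerivAt.comp x hsub
    have he : HasFDerivAt (fun x => inner ℝ e (x - x₀)) (innerSL ℝ e) x :=
      (innerSL ℝ e).hasFDerivAt.comp x hsub
    have hn := hsub.norm_sq
    have h2 := ((hp.const_add c).add ((he.pow 2).const_mul α)).sub (hn.const_mul β)
    refine h2.congr_fderiv ?_
    ext v
    simp [hT, inner_sub_right]
    ring
  unfold secondPartial
  rw [h1]
  have h2 : HasFDerivAt (fun x => innerSL ℝ p + T (x - x₀)) T x₀ :=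
    (T.hasFDerivAt.comp x₀ ((hasFDerivAt_id x₀).sub_const x₀)).const_add _
  rw [h2.fderiv]
  rw [hT, EuclideanSpace.inner_single_right, EuclideanSpace.inner_single_right,
    EuclideanSpace.inner_single_right, PiLp.single_apply]
  simp only [conj_trivial, eq_comm (a := j)]
  ring

/-- The quadratic form `eᵀ M e`. -/
def quadForm (M : Matrix (Fin n) (Fin n) ℝ) (e : EuclideanSpace ℝ (Fin n)) : ℝ :=
  ∑ i, ∑ j, M i j * (e i * e j)

theorem nondivOp_quadratic (a : EuclideanSpace ℝ (Fin n) → Matrix (Fin n) (Fin n) ℝ)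
    (x₀ p e : EuclideanSpace ℝ (Fin n)) (c α β : ℝ) :
    nondivOp a (fun x => c + inner ℝ p (x - x₀) + α * inner ℝ e (x - x₀) ^ 2
      - β * ‖x - x₀‖ ^ 2) x₀ = 2 * (α * quadForm (a x₀) e - β * (a x₀).trace) := by
  unfold nondivOp quadForm Matrix.trace
  simp only [secondPartial_quadratic, Finset.mul_sum, mul_sub, Finset.sum_sub_distrib]
  congr 1
  · refine Finset.sum_congr rfl fun i _ => Finset.sum_congr rfl fun j _ => by ring
  · refine Finset.sum_congr rfl fun i _ => ?_
    simp only [mul_ite, mul_one, mul_zero, Finset.sum_ite_eq, Finset.mem_univ, if_true,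
      Matrix.diag_apply]
    ring

theorem contDiff_quadratic (x₀ p e : EuclideanSpace ℝ (Fin n)) (c α β : ℝ) :
    ContDiff ℝ 2 (fun x => c + inner ℝ p (x - x₀) + α * inner ℝ e (x - x₀) ^ 2
      - β * ‖x - x₀‖ ^ 2) := by
  have h1 : ContDiff ℝ 2 fun x : EuclideanSpace ℝ (Fin n) => x - x₀ := contDiff_id.sub contDiff_const
  have h2 := h1.norm_sq ℝ
  have h3 : ContDiff ℝ 2 fun x : EuclideanSpace ℝ (Fin n) => inner ℝ p (x - x₀) :=
    contDiff_const.inner ℝ h1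
  have h4 : ContDiff ℝ 2 fun x : EuclideanSpace ℝ (Fin n) => inner ℝ e (x - x₀) :=
    contDiff_const.inner ℝ h1
  exact ((contDiff_const.add h3).add (contDiff_const.mul (h4.pow 2))).sub (contDiff_const.mul h2)

variable {A : EuclideanSpace ℝ (Fin n) → Matrix (Fin n) (Fin n) ℝ} {ε : ℝ}
  {Ω : Set (EuclideanSpace ℝ (Fin n))} {u : EuclideanSpace ℝ (Fin n) → ℝ}

theorem quadratic_rescale (hε : 0 < ε) (c α β : ℝ) (p e x X₀ : EuclideanSpace ℝ (Fin n)) :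
    c + inner ℝ (ε⁻¹ • p) (x - ε • X₀) + ε⁻¹ ^ 2 * α * inner ℝ e (x - ε • X₀) ^ 2
      - ε⁻¹ ^ 2 * β * ‖x - ε • X₀‖ ^ 2 =
    c + inner ℝ p (ε⁻¹ • x - X₀) + α * inner ℝ e (ε⁻¹ • x - X₀) ^ 2
      - β * ‖ε⁻¹ • x - X₀‖ ^ 2 := by
  have h : ε⁻¹ • x - X₀ = ε⁻¹ • (x - ε • X₀) := by
    rw [smul_sub, smul_smul, inv_mul_cancel₀ hε.ne', one_smul]
  rw [h, real_inner_smul_left, real_inner_smul_right, real_inner_smul_right, norm_smul,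
    Real.norm_of_nonneg (by positivity)]
  ring

theorem tendsto_inv_smul_nhds (hε : 0 < ε) (X₀ : EuclideanSpace ℝ (Fin n)) :
    Tendsto (fun x => ε⁻¹ • x) (𝓝 (ε • X₀)) (𝓝 X₀) := by
  have : ContinuousAt (fun x : EuclideanSpace ℝ (Fin n) => ε⁻¹ • x) (ε • X₀) := by fun_prop
  have h := this.tendsto
  rwa [smul_smul, inv_mul_cancel₀ hε.ne', one_smul] at h

/-- Quadratic tests from below for the rescaled solution. -/
theorem IsViscositySolution.rescaled_test_below (hε : 0 < ε)
    (hu : IsViscositySolution (fun x => A (ε⁻¹ • x)) Ω u) {X₀ p e : EuclideanSpace ℝ (Fin n)}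
    {α β : ℝ} (hX₀ : ε • X₀ ∈ Ω)
    (h : ∀ᶠ X in 𝓝 X₀, u (ε • X₀) + inner ℝ p (X - X₀) + α * inner ℝ e (X - X₀) ^ 2
      - β * ‖X - X₀‖ ^ 2 ≤ u (ε • X)) :
    α * quadForm (A X₀) e ≤ β * (A X₀).trace := by
  have h1 := hu.supersolution (ε • X₀) hX₀ _
    (contDiff_quadratic (ε • X₀) (ε⁻¹ • p) e (u (ε • X₀)) (ε⁻¹ ^ 2 * α) (ε⁻¹ ^ 2 * β)).contDiffAt
    (by simp) (by
      filter_upwards [(tendsto_inv_smul_nhds hε X₀).eventually h] with x hx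
      rw [quadratic_rescale hε]
      rwa [smul_smul, mul_inv_cancel₀ hε.ne', one_smul] at hx)
  rw [nondivOp_quadratic, smul_smul, inv_mul_cancel₀ hε.ne', one_smul] at h1
  have h2 : 0 < ε⁻¹ ^ 2 := by positivity
  refine le_of_mul_le_mul_left ?_ h2
  linarith

/-- Quadratic tests from above for the rescaled solution. -/
theorem IsViscositySolution.rescaled_test_above (hε : 0 < ε)
    (hu : IsViscositySolution (fun x => A (ε⁻¹ • x)) Ω u) {X₀ p e : EuclideanSpace ℝ (Fin n)}
    {α β : ℝ} (hX₀ : ε • X₀ ∈ Ω)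
    (h : ∀ᶠ X in 𝓝 X₀, -u (ε • X₀) + inner ℝ p (X - X₀) + α * inner ℝ e (X - X₀) ^ 2
      - β * ‖X - X₀‖ ^ 2 ≤ -u (ε • X)) :
    α * quadForm (A X₀) e ≤ β * (A X₀).trace := by
  have h1 := hu.subsolution (ε • X₀) hX₀ _
    (contDiff_quadratic (ε • X₀) (ε⁻¹ • (-p)) e (u (ε • X₀)) (ε⁻¹ ^ 2 * (-α))
      (ε⁻¹ ^ 2 * (-β))).contDiffAt
    (by simp) (by
      filter_upwards [(tendsto_inv_smul_nhds hε X₀).eventually h] with x hx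
      rw [quadratic_rescale hε]
      rw [smul_smul, mul_inv_cancel₀ hε.ne', one_smul] at hx
      rw [inner_neg_left]
      linarith)
  rw [nondivOp_quadratic, smul_smul, inv_mul_cancel₀ hε.ne', one_smul] at h1
  have h2 : 0 < ε⁻¹ ^ 2 := by positivity
  refine le_of_mul_le_mul_left ?_ h2
  linarith

/-- A convex paraboloid is the test with `α = 0` and negative `β`, which positivity of the trace
rules out. -/
theorem superTest_of_quadratic_test {U Ω : Set (EuclideanSpace ℝ (Fin n))} {L : ℝ}
    {v : EuclideanSpace ℝ (Fin n) → ℝ} (htr : ∀ X, 0 < (A X).trace)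
    (hell : ∀ X ∈ U, ∀ e : EuclideanSpace ℝ (Fin n), ‖e‖ = 1 → ∀ α β : ℝ, 0 ≤ α → 0 < β →
      α * quadForm (A X) e ≤ β * (A X).trace → α ≤ L * β)
    (htest : ∀ X₀ ∈ Ω, ∀ (p e : EuclideanSpace ℝ (Fin n)) (α β : ℝ),
      (∀ᶠ X in 𝓝 X₀, v X₀ + inner ℝ p (X - X₀) + α * inner ℝ e (X - X₀) ^ 2
        - β * ‖X - X₀‖ ^ 2 ≤ v X) → α * quadForm (A X₀) e ≤ β * (A X₀).trace) :
    SuperTest v U Ω L where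
  degenerate X₀ hX₀ p β hβ hev := by
    have h1 := htest X₀ hX₀ p 0 0 (-β) (by
      filter_upwards [hev] with X hX
      linarith)
    nlinarith [htr X₀]
  elliptic X₀ hX₀ p e he α β hα hβ hev := by
    refine hell X₀ hX₀.2 e he α β hα hβ (htest X₀ hX₀.1 p e α β ?_)
    filter_upwards [hev] with X hX
    simpa using hX

theorem quadForm_eq_dotProduct (M : Matrix (Fin n) (Fin n) ℝ) (e : EuclideanSpace ℝ (Fin n)) :
    quadForm M e = star e.ofLp ⬝ᵥ M.mulVec e.ofLp := by
  simp only [quadForm, dotProduct, Matrix.mulVec, Finset.mul_sum, Pi.star_apply, star_trivial]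
  exact Finset.sum_congr rfl fun i _ => Finset.sum_congr rfl fun j _ => by ring

theorem quadForm_ge_of_posSemidef {M : Matrix (Fin n) (Fin n) ℝ} {l : ℝ}
    (h : (M - l • (1 : Matrix (Fin n) (Fin n) ℝ)).PosSemidef) (e : EuclideanSpace ℝ (Fin n)) :
    l * ‖e‖ ^ 2 ≤ quadForm M e := by
  have h1 := h.dotProduct_mulVec_nonneg e.ofLp
  rw [Matrix.sub_mulVec, dotProduct_sub, ← quadForm_eq_dotProduct, Matrix.smul_mulVec,
    Matrix.one_mulVec, dotProduct_smul] at h1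
  have h2 : star e.ofLp ⬝ᵥ e.ofLp = ‖e‖ ^ 2 := by
    rw [EuclideanSpace.norm_sq_eq]
    simp only [dotProduct, Pi.star_apply, star_trivial, Real.norm_eq_abs, sq_abs]
    exact Finset.sum_congr rfl fun i _ => by ring
  rw [h2, smul_eq_mul] at h1
  linarith

theorem trace_le_of_posSemidef {M : Matrix (Fin n) (Fin n) ℝ} {l : ℝ}
    (h : (l • (1 : Matrix (Fin n) (Fin n) ℝ) - M).PosSemidef) : M.trace ≤ n * l := by
  have h1 := h.trace_nonneg
  rw [Matrix.trace_sub, Matrix.trace_smul, Matrix.trace_one, Fintype.card_fin, smul_eq_mul] at h1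
  linarith

theorem trace_pos_of_posSemidef {M : Matrix (Fin n) (Fin n) ℝ} {l : ℝ} (hl : 0 ≤ l) (hM : M ≠ 0)
    (h : (M - l • (1 : Matrix (Fin n) (Fin n) ℝ)).PosSemidef) : 0 < M.trace := by
  have h1 : M.PosSemidef := by
    have := h.add (Matrix.PosSemidef.one.smul hl)
    rwa [sub_add_cancel] at this
  exact h1.trace_nonneg.lt_of_ne fun h2 => hM (h1.trace_eq_zero_iff.1 h2.symm)

end Viscosity

/-! ### Uniform ellipticity near the faces -/

section Ellipticity

variable {n : ℕ}

theorem IsUnitPeriodic.periodic_sum {f : EuclideanSpace ℝ (Fin n) → ℝ} (hf : IsUnitPeriodic f)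
    (k : Fin n → ℤ) (s : Finset (Fin n)) :
    Function.Periodic f (∑ i ∈ s, k i • EuclideanSpace.single i (1 : ℝ)) := by
  induction s using Finset.induction_on with
  | empty => intro x; simp
  | insert i s hi ih =>
    rw [Finset.sum_insert hi]
    have h : Function.Periodic f (EuclideanSpace.single i (1 : ℝ)) := fun x => hf x i
    exact (h.zsmul (k i)).add_period ih

theorem sum_zsmul_single_apply (k : Fin n → ℤ) (j : Fin n) :
    (∑ i, k i • EuclideanSpace.single i (1 : ℝ)) j = k j := by
  rw [WithLp.ofLp_sum, Finset.sum_apply]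
  simp [PiLp.single_apply]

/-- Points of the unit cube that are close to a face lie outside `D`. -/
theorem notMem_of_close_to_face {D : Set (EuclideanSpace ℝ (Fin n))} {d d' : ℝ}
    (hdd : d' ≤ d) (hd2 : d' ≤ 1 / 2)
    (hD : ∀ x ∈ closure D, ∀ y ∈ frontier (unitCube n), d ≤ dist x y)
    {x : EuclideanSpace ℝ (Fin n)} (hx : x ∈ unitCube n) {i : Fin n} {k : ℤ}
    (hk : |x i - (k + 1 / 2)| < d') : x ∉ D := by
  intro hxD
  have hxi := abs_lt.1 (hx i)
  have hk' := abs_lt.1 hk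
  have hk2 : |(k : ℝ) + 1 / 2| = 1 / 2 := by
    have h1 : (k : ℝ) < 1 := by linarith
    have h2 : (-2 : ℝ) < k := by linarith
    have h3 : k < 1 := by exact_mod_cast h1
    have h4 : -2 < k := by exact_mod_cast h2
    obtain rfl | rfl : k = -1 ∨ k = 0 := by omega
    · norm_num [abs_of_neg]
    · norm_num
  obtain ⟨w, hw⟩ : ∃ w : EuclideanSpace ℝ (Fin n),
    w = EuclideanSpace.single i ((k : ℝ) + 1 / 2 - x i) := ⟨_, rfl⟩
  have hcoord : ∀ (t : ℝ) (j : Fin n), (x + t • w) j =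
      if j = i then x i + t * (k + 1 / 2 - x i) else x j := by
    intro t j
    rw [PiLp.add_apply, PiLp.smul_apply, hw, PiLp.single_apply]
    split_ifs with h
    · rw [h, smul_eq_mul]
    · simp
  -- Moving coordinate `i` onto the nearby face reaches the boundary of the cube at distance less
  -- than `d'`.
  have hy : x + w ∈ frontier (unitCube n) := by
    refine ⟨?_, fun hint => ?_⟩
    · have hT : Tendsto (fun t : ℝ => x + t • w) (𝓝[<] 1) (𝓝 (x + w)) := by
        have hc : ContinuousAt (fun t : ℝ => x + t • w) 1 := by fun_prop
        have := hc.tendsto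
        rw [one_smul] at this
        exact this.mono_left nhdsWithin_le_nhds
      refine mem_closure_of_tendsto hT ?_
      filter_upwards [Ioo_mem_nhdsLT (show (0 : ℝ) < 1 by norm_num)] with t ht j
      rw [hcoord]
      split_ifs with h
      · have e : x i + t * (k + 1 / 2 - x i) = (1 - t) * x i + t * (k + 1 / 2) := by ring
        rw [e]
        calc |(1 - t) * x i + t * (k + 1 / 2)| ≤ |(1 - t) * x i| + |t * (k + 1 / 2)| :=
              abs_add_le _ _
          _ = (1 - t) * |x i| + t * (1 / 2) := by
              rw [abs_mul, abs_mul, hk2, abs_of_pos ht.1, abs_of_pos (by linarith [ht.2])]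
          _ < 1 / 2 := by nlinarith [hx i, ht.2]
      · exact hx j
    · have h1 := interior_subset hint i
      have h2 := hcoord 1 i
      rw [one_smul, if_pos rfl, one_mul] at h2
      rw [h2, add_sub_cancel, hk2] at h1
      exact lt_irrefl _ h1
  have h1 := hD x (subset_closure hxD) _ hy
  rw [dist_self_add_right, hw, PiLp.norm_single, Real.norm_eq_abs, abs_sub_comm] at h1
  linarith

theorem eventually_add_const_apply_ne (x : EuclideanSpace ℝ (Fin n)) :
    ∀ᶠ t : ℝ in 𝓝[>] 0, ∀ (i : Fin n) (k : ℤ), x i + t ≠ k + 1 / 2 := by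
  rw [eventually_all]
  intro i
  have h1 : 0 < (⌊x i - 1 / 2⌋ : ℝ) + 1 - (x i - 1 / 2) := by
    linarith [Int.lt_floor_add_one (x i - 1 / 2)]
  filter_upwards [Ioo_mem_nhdsGT h1] with t ht k hk
  have h2 : (⌊x i - 1 / 2⌋ : ℝ) < k := by linarith [Int.floor_le (x i - 1 / 2), ht.1]
  have h3 : (k : ℝ) < ⌊x i - 1 / 2⌋ + 1 := by linarith [ht.2]
  have h4 : ⌊x i - 1 / 2⌋ < k := by exact_mod_cast h2
  have h5 : k < ⌊x i - 1 / 2⌋ + 1 := by exact_mod_cast h3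
  omega

/-- Uniform ellipticity near the faces of the lattice cubes. -/
theorem elliptic_of_mem_frameNhd {lamMin lamMax d d' : ℝ}
    (hdd : d' ≤ d) (hd2 : d' ≤ 1 / 2) {A : EuclideanSpace ℝ (Fin n) → Matrix (Fin n) (Fin n) ℝ}
    {lMin lMax : EuclideanSpace ℝ (Fin n) → ℝ} {D : Set (EuclideanSpace ℝ (Fin n))}
    (hA : Continuous A)
    (hmin : ∀ x, (A x - lMin x • (1 : Matrix (Fin n) (Fin n) ℝ)).PosSemidef)
    (hmax : ∀ x, (lMax x • (1 : Matrix (Fin n) (Fin n) ℝ) - A x).PosSemidef)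
    (hpmin : IsUnitPeriodic lMin) (hpmax : IsUnitPeriodic lMax)
    (hD : ∀ x ∈ closure D, ∀ y ∈ frontier (unitCube n), d ≤ dist x y)
    (hell : ∀ x ∈ unitCube n \ D, lamMin ≤ lMin x ∧ lMin x ≤ lMax x ∧ lMax x ≤ lamMax)
    {X : EuclideanSpace ℝ (Fin n)} (hX : X ∈ frameNhd n d') (e : EuclideanSpace ℝ (Fin n)) :
    lamMin * ‖e‖ ^ 2 ≤ quadForm (A X) e ∧ (A X).trace ≤ n * lamMax := by
  -- Only the eigenvalue bounds are periodic, so these are translated while `A` stays at `Y`.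
  -- Without half-integer coordinates, `Y` translates into the open cube.
  have key : ∀ Y ∈ frameNhd n d', (∀ (i : Fin n) (k : ℤ), Y i ≠ k + 1 / 2) →
      lamMin * ‖e‖ ^ 2 ≤ quadForm (A Y) e ∧ (A Y).trace ≤ n * lamMax := by
    rintro Y ⟨i, k, hk⟩ hne
    obtain ⟨r, hr⟩ : ∃ r : Fin n → ℤ, ∀ j, r j = round (Y j) := ⟨_, fun _ => rfl⟩
    obtain ⟨Z, hZ⟩ : ∃ Z, Z = Y - ∑ j, r j • EuclideanSpace.single j (1 : ℝ) := ⟨_, rfl⟩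
    have hZj : ∀ j, Z j = Y j - round (Y j) := by
      intro j
      rw [hZ, PiLp.sub_apply, sum_zsmul_single_apply, hr]
    have hZc : Z ∈ unitCube n := by
      intro j
      rw [hZj]
      refine (abs_sub_round (Y j)).lt_of_ne fun h => ?_
      rcases (abs_eq (by norm_num)).1 h with h | h
      · exact hne j (round (Y j)) (by linarith)
      · refine hne j (round (Y j) - 1) ?_
        push_cast; linarith
    have hZD : Z ∉ D := by
      refine notMem_of_close_to_face hdd hd2 hD hZc (i := i) (k := k - round (Y i)) ?_
      rw [hZj]
      push_cast
      have e1 : Y i - round (Y i) - (k - round (Y i) + 1 / 2) = Y i - (k + 1 / 2) := by ring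
      rw [e1]; exact hk
    obtain ⟨h1, -, h3⟩ := hell Z ⟨hZc, hZD⟩
    have hYZ : Y = Z + ∑ j, r j • EuclideanSpace.single j (1 : ℝ) := by rw [hZ]; abel
    have e1 : lMin Y = lMin Z := by rw [hYZ]; exact hpmin.periodic_sum r Finset.univ Z
    have e2 : lMax Y = lMax Z := by rw [hYZ]; exact hpmax.periodic_sum r Finset.univ Z
    rw [← e1] at h1
    rw [← e2] at h3
    constructor
    · exact le_trans (by gcongr) (quadForm_ge_of_posSemidef (hmin Y) e)
    · exact (trace_le_of_posSemidef (hmax Y)).trans (by gcongr)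
  -- Points on the faces are limits along the diagonal of points covered by `key`, and `A` is
  -- continuous.
  obtain ⟨w, hw⟩ : ∃ w : EuclideanSpace ℝ (Fin n), ∀ i, w i = 1 :=
    ⟨WithLp.toLp 2 fun _ => 1, fun _ => rfl⟩
  have hcoord : ∀ (t : ℝ) (i : Fin n), (X + t • w) i = X i + t := by
    intro t i
    rw [PiLp.add_apply, PiLp.smul_apply, hw, smul_eq_mul, mul_one]
  have hc : ContinuousAt (fun t : ℝ => X + t • w) 0 := by fun_prop
  have hT : Tendsto (fun t : ℝ => X + t • w) (𝓝[>] 0) (𝓝 X) := by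
    have := hc.tendsto
    rw [zero_smul, add_zero] at this
    exact this.mono_left nhdsWithin_le_nhds
  have hfr : ∀ᶠ t : ℝ in 𝓝[>] 0, X + t • w ∈ frameNhd n d' := by
    obtain ⟨i, k, hk⟩ := hX
    have h1 : ContinuousAt (fun t : ℝ => |X i + t - (k + 1 / 2)|) 0 := by fun_prop
    have h2 : ∀ᶠ t : ℝ in 𝓝 0, |X i + t - (k + 1 / 2)| < d' :=
      h1.eventually_lt continuousAt_const (by simpa using hk)
    filter_upwards [nhdsWithin_le_nhds h2] with t ht
    exact ⟨i, k, by rw [hcoord]; exact ht⟩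
  have hev : ∀ᶠ t : ℝ in 𝓝[>] 0, lamMin * ‖e‖ ^ 2 ≤ quadForm (A (X + t • w)) e ∧
      (A (X + t • w)).trace ≤ n * lamMax := by
    filter_upwards [hfr, eventually_add_const_apply_ne X] with t h1 h2
    exact key _ h1 fun i k => by rw [hcoord]; exact h2 i k
  have hAij : ∀ i j, Continuous fun x => A x i j := fun i j => by fun_prop
  have hq : Continuous fun x => quadForm (A x) e := by
    unfold quadForm; fun_prop
  have htr : Continuous fun x => (A x).trace := hA.matrix_trace
  constructor
  · exact ge_of_tendsto ((hq.tendsto X).comp hT) (hev.mono fun t ht => ht.1)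
  · exact le_of_tendsto ((htr.tendsto X).comp hT) (hev.mono fun t ht => ht.2)

/-- In the elliptic region, the coefficients have bounded ellipticity ratio. -/
theorem ratio_le_of_mem_ellipticRegion {lamMin lamMax d d' : ℝ} (hlam : 0 < lamMin)
    (hdd : d' ≤ d) (hd2 : d' ≤ 1 / 2) {A : EuclideanSpace ℝ (Fin n) → Matrix (Fin n) (Fin n) ℝ}
    {lMin lMax : EuclideanSpace ℝ (Fin n) → ℝ} {D : Set (EuclideanSpace ℝ (Fin n))}
    (hA : Continuous A) (hpos : ∀ x, 0 < (A x).trace)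
    (hmin : ∀ x, (A x - lMin x • (1 : Matrix (Fin n) (Fin n) ℝ)).PosSemidef)
    (hmax : ∀ x, (lMax x • (1 : Matrix (Fin n) (Fin n) ℝ) - A x).PosSemidef)
    (hpmin : IsUnitPeriodic lMin) (hpmax : IsUnitPeriodic lMax)
    (hD : ∀ x ∈ closure D, ∀ y ∈ frontier (unitCube n), d ≤ dist x y)
    (hell : ∀ x ∈ unitCube n \ D, lamMin ≤ lMin x ∧ lMin x ≤ lMax x ∧ lMax x ≤ lamMax)
    {X : EuclideanSpace ℝ (Fin n)} (hX : X ∈ ellipticRegion n d') {e : EuclideanSpace ℝ (Fin n)}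
    (he : ‖e‖ = 1) {α β : ℝ} (hα : 0 ≤ α) (hβ : 0 < β)
    (h : α * quadForm (A X) e ≤ β * (A X).trace) : α ≤ (1 + n * |lamMax| / lamMin) * β := by
  rcases hX with rfl | hX
  -- In dimension one the quadratic form at a unit vector is the trace, so the ratio is 1.
  · have h1 : e 0 ^ 2 = 1 := by
      have := EuclideanSpace.norm_sq_eq e
      rw [he] at this
      simpa using this.symm
    have h2 : quadForm (A X) e = (A X).trace := by
      simp only [quadForm, Matrix.trace, Fin.sum_univ_one, Matrix.diag_apply, Fin.isValue]
      rw [← sq, h1, mul_one]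
    rw [h2] at h
    have h3 := le_of_mul_le_mul_right h (hpos X)
    have h4 : 0 ≤ ((1 : ℕ) : ℝ) * |lamMax| / lamMin * β := by positivity
    linarith
  · obtain ⟨h1, h2⟩ := elliptic_of_mem_frameNhd hdd hd2 hA hmin hmax hpmin hpmax hD hell hX e
    rw [he, one_pow, mul_one] at h1
    have h3 : α * lamMin ≤ β * (n * |lamMax|) := by
      calc α * lamMin ≤ α * quadForm (A X) e := by gcongr
        _ ≤ β * (A X).trace := h
        _ ≤ β * (n * lamMax) := by gcongr
        _ ≤ β * (n * |lamMax|) := by gcongr; exact le_abs_self _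
    have h4 : α ≤ β * (n * |lamMax|) / lamMin := by rwa [le_div_iff₀ hlam]
    calc α ≤ β * (n * |lamMax|) / lamMin := h4
      _ = n * |lamMax| / lamMin * β := by ring
      _ ≤ _ := by linarith

end Ellipticity

/-! ### Rescaling and conclusion -/

theorem theorem4p2 (n : ℕ) (lamMin lamMax : ℝ) (hlam : 0 < lamMin)
    (d : ℝ) (hd : 0 < d) :
    ∃ C γ : ℝ, 0 < C ∧ 0 < γ ∧ γ < 1 ∧
      ∀ (A : EuclideanSpace ℝ (Fin n) → Matrix (Fin n) (Fin n) ℝ)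
        (lMin lMax : EuclideanSpace ℝ (Fin n) → ℝ)
        (D : Set (EuclideanSpace ℝ (Fin n))),
        Continuous A →
        (∀ x, A x ≠ 0) →
        -- `lMin x • I ≤ A x ≤ lMax x • I` as symmetric matrices
        (∀ x, (A x - lMin x • (1 : Matrix (Fin n) (Fin n) ℝ)).PosSemidef) →
        (∀ x, (lMax x • (1 : Matrix (Fin n) (Fin n) ℝ) - A x).PosSemidef) →
        (∀ x, 0 ≤ lMin x) →
        (∀ x, 0 ≤ lMax x) →
        IsUnitPeriodic lMin →
        IsUnitPeriodic lMax →
        -- `D` is compactly contained in `Q₁`, at distance at least `d` from its boundary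
        closure D ⊆ unitCube n →
        (∀ x ∈ closure D, ∀ y ∈ frontier (unitCube n), d ≤ dist x y) →
        (∀ x ∈ unitCube n \ D, lamMin ≤ lMin x ∧ lMin x ≤ lMax x ∧ lMax x ≤ lamMax) →
        ∀ (ε : ℝ), 0 < ε →
        ∀ (u : EuclideanSpace ℝ (Fin n) → ℝ),
          IsViscositySolution (fun x => A (ε⁻¹ • x)) (Metric.ball 0 1) u →
          (∀ x ∈ Metric.ball (0 : EuclideanSpace ℝ (Fin n)) 1, |u x| ≤ 1) →
          ∀ x ∈ Metric.ball (0 : EuclideanSpace ℝ (Fin n)) (1 / 2),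
          ∀ y ∈ Metric.ball (0 : EuclideanSpace ℝ (Fin n)) (1 / 2),
            ε ≤ dist x y → |u x - u y| ≤ C * dist x y ^ γ := by
  rcases Nat.eq_zero_or_pos n with rfl | hn
  · refine ⟨1, 1 / 2, by norm_num, by norm_num, by norm_num, ?_⟩
    intro A lMin lMax D _ _ _ _ _ _ _ _ _ _ _ ε hε u _ _ x _ y _ hxy
    rw [Subsingleton.elim x y, dist_self] at hxy
    linarith
  -- The corrector is nonconvex only within `d'/2` of the faces, while ellipticity holds within
  -- `d'`; the margin `d'/2` makes room for the balls of radius `6σ`, with `σ = d'/80`.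
  obtain ⟨d', hd'⟩ : ∃ d', d' = min d (1 / 4) := ⟨_, rfl⟩
  have hd'0 : 0 < d' := by rw [hd']; exact lt_min hd (by norm_num)
  have hd'd : d' ≤ d := by rw [hd']; exact min_le_left _ _
  have hd'4 : d' ≤ 1 / 4 := by rw [hd']; exact min_le_right _ _
  obtain ⟨ω, κ, m, hω⟩ := exists_isCorrector n (η := d' / 2) (by linarith) (by linarith)
  obtain ⟨L, hL⟩ : ∃ L, L = 1 + n * |lamMax| / lamMin := ⟨_, rfl⟩
  have hL1 : 1 ≤ L := by
    have : 0 ≤ n * |lamMax| / lamMin := by positivity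
    linarith
  obtain ⟨C, γ, hC, hγ0, hγ1, H⟩ := exists_hoelder_large_scale
    (V := EuclideanSpace ℝ (Fin n)) (σ := d' / 80) (M := n) hL1 hω.kappa_nonneg
    ((hω.nonneg 0).trans (hω.le_bound 0)) (by linarith) (by positivity)
  -- The factor `4 ^ γ` reflects the radius `1/4` of the balls around `x ∈ B_{1/2}`, before
  -- rescaling.
  refine ⟨C * 4 ^ γ, γ, by positivity, hγ0, hγ1, ?_⟩
  intro A lMin lMax D hA hA0 hmin hmax hlMin0 _ hpmin hpmax _ hD hell ε hε u hu hu1 x hx y hy hxy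
  have htr : ∀ X, 0 < (A X).trace := fun X => trace_pos_of_posSemidef (hlMin0 X) (hA0 X) (hmin X)
  have hratio : ∀ X ∈ ellipticRegion n d', ∀ e : EuclideanSpace ℝ (Fin n), ‖e‖ = 1 →
      ∀ α β : ℝ, 0 ≤ α → 0 < β → α * quadForm (A X) e ≤ β * (A X).trace → α ≤ L * β := by
    intro X hX e he α β hα hβ h
    rw [hL]
    exact ratio_le_of_mem_ellipticRegion hlam hd'd (by linarith) hA htr hmin hmax hpmin hpmax hD
      hell hX he hα hβ h
  have hmaps : ∀ X ∈ Metric.closedBall (ε⁻¹ • x) (1 / (4 * ε)),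
      ε • X ∈ Metric.ball (0 : EuclideanSpace ℝ (Fin n)) 1 := by
    intro X hX
    rw [mem_ball_zero_iff] at hx ⊢
    rw [mem_closedBall_iff_norm] at hX
    have e1 : ε • X = ε • (X - ε⁻¹ • x) + x := by
      rw [smul_sub, smul_smul, mul_inv_cancel₀ hε.ne', one_smul, sub_add_cancel]
    have h1 : ‖ε • (X - ε⁻¹ • x)‖ ≤ 1 / 4 := by
      rw [norm_smul, Real.norm_of_nonneg hε.le]
      calc ε * ‖X - ε⁻¹ • x‖ ≤ ε * (1 / (4 * ε)) := by gcongr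
        _ = 1 / 4 := by field_simp
    rw [e1]
    linarith [norm_add_le (ε • (X - ε⁻¹ • x)) x]
  have hdist : dist (ε⁻¹ • x) (ε⁻¹ • y) = ε⁻¹ * dist x y := by
    rw [dist_smul₀, Real.norm_of_nonneg (by positivity)]
  have hcancel : ∀ z : EuclideanSpace ℝ (Fin n), ε • ε⁻¹ • z = z := fun z => by
    rw [smul_smul, mul_inv_cancel₀ hε.ne', one_smul]
  have key := H (fun X => u (ε • X)) ω (ellipticRegion n d') (frameNhd n (d' / 2)) (ε⁻¹ • x)
    (1 / (4 * ε)) (by positivity) hω (frameNhd_subset_ellipticRegion (by linarith))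
    (joinedInside_ellipticRegion hn hd'0)
    (hu.continuousOn.comp (continuous_const_smul ε).continuousOn hmaps)
    (superTest_of_quadratic_test htr hratio fun X₀ hX₀ p e α β h =>
      hu.rescaled_test_below hε (hmaps X₀ (Metric.ball_subset_closedBall hX₀)) h)
    (superTest_of_quadratic_test htr hratio fun X₀ hX₀ p e α β h =>
      hu.rescaled_test_above hε (hmaps X₀ (Metric.ball_subset_closedBall hX₀)) h)
    (ε⁻¹ • y) (by rw [hdist, inv_mul_eq_div, le_div_iff₀ hε]; linarith)
    (fun X hX => hu1 _ (hmaps X hX))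
    (by
      simp only [hcancel]
      exact hu1 y (Metric.ball_subset_ball (by norm_num) hy))
  simp only [hcancel] at key
  rw [hdist] at key
  have e1 : ε⁻¹ * dist x y / (1 / (4 * ε)) = 4 * dist x y := by field_simp
  rw [e1, Real.mul_rpow (by norm_num) dist_nonneg, ← mul_assoc] at key
  exact key
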